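/- Let $L\ge 3$ be odd, let $\mathbb Z_L=\mathbb Z/L\mathbb Z$, and let $\mu$ be the probability measure on $\mathbb Z_L$ with $\mu(1)=\mu(-1)=1/2$. For $\alpha\in[0,1)$ the step-reinforced random walk (SRRW) $S=(S_n)_{n\ge 0}$ on $\mathbb Z_L$ with step distribution $\mu$ and reinforcement parameter $\alpha$ is defined as follows. Let $(\xi_n)_{n\ge2}$ be Bernoulli($\alpha$) variables, let $u_n$ ($n\ge 2$) be uniform on $\{1,\dots,n-1\}$, and let $(Y_n)_{n\ge 1}$ have law $\mu$, all of these variables being independent. Put $S_0=0$, $X_1=Y_1$, and for $n\ge2$ put $X_n=X_{u_n}$ if $\xi_n=1$ and $X_n=Y_n$ if $\xi_n=0$; finally $S_n=S_{n-1}+X_n$ for $n\ge1$. For $\varepsilon\in(0,1)$ the $\varepsilon$-mixing time is $$t^{(\alpha)}_{\mathrm{mix}}(\varepsilon)=\inf\{n\ge1:\ \|\mathbb P(S_m=\cdot)-U\|_{\mathrm{TV}}\le\varepsilon\ \text{ for all } m\ge n\},$$ where $U$ is the uniform distribution on $\mathbb Z_L$ and $\|\nu_1-\nu_2\|_{\mathrm{TV}}=\sup_{A\subseteq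 \mathbb Z_L}|\nu_1(A)-\nu_2(A)|$. Theorem 1.6. Fix $\varepsilon\in(0,1)$. (i) If $\alpha\in[0,1/2)$, there are constants $c_1,C_1>0$ depending only on $\alpha,\varepsilon$ such that for all sufficiently large odd $L$, $$c_1L^2\le t^{(\alpha)}_{\mathrm{mix}}(\varepsilon)\le C_1L^2 .$$ (ii) If $\alpha=1/2$, there are constants $c_2,C_2>0$ depending only on $\varepsilon$ such that for all sufficiently large odd $L$, $$\frac{c_2L^2}{\log L}\le t^{(\alpha)}_{\mathrm{mix}}(\varepsilon)\le \frac{C_2L^2}{\log L}.$$ (iii) If $\alpha\in(1/2,1)$, there are constants $c_3,C_3>0$ depending only on $\alpha,\varepsilon$ such that for all sufficiently large odd $L$, $$c_3L^{1/\alpha}\le t^{(\alpha)}_{\mathrm{mix}}(\varepsilon)\le C_3L^{1/\alpha}.$$ In each part, how large $L$ has to be depends only on $\alpha$ and $\varepsilon$. -/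

import Mathlib

open MeasureTheory ProbabilityTheory

universe w

/-- `S` is the step-reinforced random walk on the (additively written) discrete group `G`, started
at the identity, with step distribution `μ` and reinforcement parameter `α`, built on `(Ω, P)` from
the reinforcement coins `ξ n` and the uniform times `u n` for `n ≥ 2`, and from the fresh samples
`Y n` for `n ≥ 1`; `X n`, for `n ≥ 1`, is its step sequence. All coins, times and fresh samples are
independent: the triples `(ξ n, u n, Y n)` are independent of each other, and for `n ≥ 2` the three
components of a triple are independent. The values `ξ 0`, `ξ 1`, `u 0`, `u 1`, `Y 0`, `X 0` play no
role in the walk. -/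
structure IsSRRWDrivenBy {Ω G : Type*} [MeasurableSpace Ω] [AddGroup G] [MeasurableSpace G]
    (P : Measure Ω) (α : unitInterval) (μ : Measure G)
    (ξ : ℕ → Ω → Bool) (u : ℕ → Ω → ℕ) (Y X S : ℕ → Ω → G) : Prop where
  measurable_coin : ∀ n, Measurable (ξ n)
  measurable_time : ∀ n, Measurable (u n)
  measurable_fresh : ∀ n, Measurable (Y n)
  /-- The data used at different times are independent. -/
  indep : iIndepFun (fun n ω => (ξ n ω, u n ω, Y n ω)) P
  /-- The first step is sampled from `μ`. -/
  law_first : P.map (Y 1) = μ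
  /-- At time `n ≥ 2`: a Bernoulli(`α`) coin, a uniform element of `{1, …, n - 1}` and a fresh
  sample from `μ`, all independent. -/
  law_triple : ∀ n, 2 ≤ n → P.map (fun ω => (ξ n ω, u n ω, Y n ω)) =
    (bernoulliMeasure true false α).prod ((uniformOn (Set.Ico 1 n)).prod μ)
  time_mem : ∀ n, 2 ≤ n → ∀ ω, u n ω ∈ Set.Ico 1 n
  step_one : ∀ ω, X 1 ω = Y 1 ω
  step : ∀ n, 2 ≤ n → ∀ ω, X n ω = if ξ n ω = true then X (u n ω) ω else Y n ω
  walk_zero : ∀ ω, S 0 ω = 0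
  walk_succ : ∀ n ω, S (n + 1) ω = S n ω + X (n + 1) ω

/-- `S` is a step-reinforced random walk on `G`, started at the identity, with step distribution
`μ` and reinforcement parameter `α`. -/
def IsSRRW {Ω G : Type*} [MeasurableSpace Ω] [AddGroup G] [MeasurableSpace G]
    (P : Measure Ω) (α : unitInterval) (μ : Measure G) (S : ℕ → Ω → G) : Prop :=
  ∃ (ξ : ℕ → Ω → Bool) (u : ℕ → Ω → ℕ) (Y X : ℕ → Ω → G), IsSRRWDrivenBy P α μ ξ u Y X S

/-- The total variation distance of two probability measures on a finite (discrete) space. -/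
noncomputable def tvDist {G : Type*} [MeasurableSpace G] (ν₁ ν₂ : Measure G) : ℝ :=
  ⨆ A : Set G, |ν₁.real A - ν₂.real A|

/-- The times `n ≥ 1` from which on the law of the process stays within total variation distance
`ε` of the uniform distribution. -/
def mixedTimes {Ω G : Type*} [MeasurableSpace Ω] [MeasurableSpace G]
    (P : Measure Ω) (S : ℕ → Ω → G) (ε : ℝ) : Set ℕ :=
  {n | 1 ≤ n ∧ ∀ m, n ≤ m → tvDist (P.map (S m)) (uniformOn Set.univ) ≤ ε}

/-- The `ε`-mixing time, the least element of `mixedTimes P S ε`. It is `0` if there is no such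
time and at least `1` otherwise, so a positive lower bound on it says that it exists. -/
noncomputable def mixingTime {Ω G : Type*} [MeasurableSpace Ω] [MeasurableSpace G]
    (P : Measure Ω) (S : ℕ → Ω → G) (ε : ℝ) : ℕ :=
  sInf (mixedTimes P S ε)

/-- The step distribution of simple random walk on the cycle: `±1` with probability `1/2` each. -/
noncomputable def cycleStep (L : ℕ) : Measure (ZMod L) :=
  (2⁻¹ : ENNReal) • Measure.dirac 1 + (2⁻¹ : ENNReal) • Measure.dirac (-1)

/-!
# Mixing times of step-reinforced random walks on odd cycles

The walk on the cycle is the projection of a walk `liftedWalk` on the integers. Given the past, the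
next step of the lift is `1` with probability `1 / 2 + α * s / (2 * n)`, where `s` is the position
at time `n` (`walkStep`): the lift is the elephant random walk.

*Lower bounds.* The second moment of the lift is of order `n` for `α < 1 / 2`, `n * log n` for
`α = 1 / 2` and `n ^ (2 * α)` for `α > 1 / 2`. By Chebyshev's inequality the walk stays on a short
arc as long as this is small compared with `L ^ 2`.

*Upper bounds.* The total variation distance is at most the sum of the Fourier coefficients at
nonzero frequencies (`IsSRRWDrivenBy.tvDist_le_sum`). As `L` is odd, these may be taken at the
angles `θ = π * j / L` with `1 ≤ j < L / 2`. Group the times into clusters with a common fresh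
sample. The signs of the clusters are independent, so the characteristic function is the mean of
`∏ cos (c i * θ)` over the cluster sizes `c i` (`walkMean_exp_eq`).

To bound this mean, `|cos (c * θ)|` is replaced by `exp (-g c)`, where `g` is quadratic in `c` up to
order `1 / θ` and vanishes beyond (`barrier`). Transported back in time along the growth of a
cluster, which multiplies sizes by `(n / m) ^ α` between times `m` and `n`, this function is a
subsolution of the growth dynamics (`barrier_le_step`). The product of `exp (-g (c i))` is then a
supermartingale, with a gain at each time `m`: with probability at least `1 - α` a new cluster is
founded, and it contributes `g 1` of order `θ ^ 2 * (n / m) ^ (2 * α)` as long as its typical final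
size `(n / m) ^ α` is at most of order `1 / θ`. Thus the characteristic function is at most
`exp (-c * ∑ θ ^ 2 * (n / m) ^ (2 * α))`, the sum running over `n * θ ^ (1 / α) ≲ m ≤ n`
(`cosProdMean_le`). The sum is of order `n * θ ^ 2`, `n * θ ^ 2 * log (1 / θ)` or `n * θ ^ (1 / α)`
in the three regimes, and at the times in question this is at least a large multiple of `j`.
-/

/-! ### The integer walk and its cluster sizes -/

/-- One step of the lifted walk, acting on observables: given `S n = s`, exactly `(n + s) / 2` of
the first `n` steps are `+1`, so the next step is `+1` with probability `1 / 2 + α * s / (2 * n)`.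
At `n = 0` the junk value `α * s / 0 = 0` gives the correct fair first step. -/
noncomputable def walkStep {E : Type*} [AddCommGroup E] [Module ℝ E] (α : ℝ) (n : ℕ) (f : ℤ → E)
    (s : ℤ) : E :=
  (1 / 2 + α * s / (2 * n)) • f (s + 1) + (1 / 2 - α * s / (2 * n)) • f (s - 1)

/-- The expectation of `f` at the position at time `n` of the reinforced walk on `ℤ` with fair
`±1` steps. -/
noncomputable def walkMean {E : Type*} [AddCommGroup E] [Module ℝ E] (α : ℝ) :
    ℕ → (ℤ → E) → E
  | 0, f => f 0
  | n + 1, f => walkMean α n (walkStep α n f)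

/-- One step of the cluster sizes, acting on observables. The times `1, …, n` are grouped into
clusters, `i < n` standing for the cluster founded at time `i + 1` (of size `0` if that time founds
none). Time `n + 1` founds a new cluster, unless, with probability `α * c i / n`, it joins
cluster `i`. -/
noncomputable def clusterStep (α : ℝ) (n : ℕ) (G : (ℕ → ℕ) → ℝ) (c : ℕ → ℕ) : ℝ :=
  G (Function.update c n 1) + α / n * ∑ i ∈ Finset.range n,
    (c i : ℝ) * (G (Function.update c i (c i + 1)) - G (Function.update c n 1))

/-- The expectation of `G` at the vector of cluster sizes at time `n`. -/
noncomputable def clusterMean (α : ℝ) : ℕ → ((ℕ → ℕ) → ℝ) → ℝ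
  | 0, G => G 0
  | n + 1, G => clusterMean α n (clusterStep α n G)

/-- The vectors of cluster sizes that can occur at time `n`. -/
def IsClusterVector (n : ℕ) (c : ℕ → ℕ) : Prop :=
  ∑ i ∈ Finset.range n, c i = n ∧ ∀ i, n ≤ i → c i = 0

lemma IsClusterVector.update_new {n : ℕ} {c : ℕ → ℕ} (hc : IsClusterVector n c) :
    IsClusterVector (n + 1) (Function.update c n 1) := by
  refine ⟨?_, fun i hi => ?_⟩
  · rw [Finset.sum_range_succ, Function.update_self]
    congr 1
    rw [← hc.1]
    conv_rhs => rw [← hc.1]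
    refine Finset.sum_congr (by rw [hc.1]) fun i hi => ?_
    rw [Function.update_of_ne]
    exact (Finset.mem_range.1 hi).ne
  · rw [Function.update_of_ne (by omega)]
    exact hc.2 i (by omega)

lemma IsClusterVector.update_join {n : ℕ} {c : ℕ → ℕ} (hc : IsClusterVector n c) {i : ℕ}
    (hi : i < n) : IsClusterVector (n + 1) (Function.update c i (c i + 1)) := by
  refine ⟨?_, fun j hj => ?_⟩
  · have h0 := hc.2 n le_rfl
    have hi' : i ∈ Finset.range (n + 1) := Finset.mem_range.2 (by omega)
    rw [Finset.sum_update_of_mem hi', add_right_comm, Nat.add_right_cancel_iff,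
      ← Finset.erase_eq, Finset.add_sum_erase _ _ hi', Finset.sum_range_succ, h0, hc.1, add_zero]
  · rw [Function.update_of_ne (by omega)]
    exact hc.2 j (by omega)

lemma IsClusterVector.le {n : ℕ} {c : ℕ → ℕ} (hc : IsClusterVector n c) {i : ℕ} (hi : i < n) :
    c i ≤ n := by
  conv_rhs => rw [← hc.1]
  exact Finset.single_le_sum (f := c) (fun _ _ => Nat.zero_le _) (Finset.mem_range.2 hi)

lemma IsClusterVector.sum_cast {n : ℕ} {c : ℕ → ℕ} (hc : IsClusterVector n c) :
    ∑ i ∈ Finset.range n, (c i : ℝ) = n := by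
  exact_mod_cast hc.1

lemma clusterStep_mono {α : ℝ} (h0 : 0 ≤ α) (h1 : α ≤ 1) {n : ℕ} {G H : (ℕ → ℕ) → ℝ}
    (h : ∀ c, IsClusterVector (n + 1) c → G c ≤ H c) {c : ℕ → ℕ} (hc : IsClusterVector n c) :
    clusterStep α n G c ≤ clusterStep α n H c := by
  have key : ∀ K : (ℕ → ℕ) → ℝ, clusterStep α n K c =
      (1 - α / n * n) * K (Function.update c n 1) +
        α / n * ∑ i ∈ Finset.range n, (c i : ℝ) * K (Function.update c i (c i + 1)) := by
    intro K
    rw [clusterStep]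
    simp only [mul_sub, Finset.sum_sub_distrib]
    rw [← Finset.sum_mul, hc.sum_cast]
    ring
  rw [key, key]
  have hα : α / n * n ≤ 1 := by
    rcases eq_or_ne (n : ℝ) 0 with hn | hn
    · simp [hn]
    · rwa [div_mul_cancel₀ _ hn]
  refine add_le_add (mul_le_mul_of_nonneg_left (h _ hc.update_new) (sub_nonneg.2 hα)) ?_
  gcongr with i hi
  exact h _ (hc.update_join (Finset.mem_range.1 hi))

lemma clusterMean_mono {α : ℝ} (h0 : 0 ≤ α) (h1 : α ≤ 1) {n : ℕ} :
    ∀ {G H : (ℕ → ℕ) → ℝ}, (∀ c, IsClusterVector n c → G c ≤ H c) →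
      clusterMean α n G ≤ clusterMean α n H := by
  induction n with
  | zero => exact fun h => h 0 ⟨by simp, by simp⟩
  | succ n ih => exact fun h => ih fun c hc => clusterStep_mono h0 h1 h hc

lemma clusterMean_congr {α : ℝ} (h0 : 0 ≤ α) (h1 : α ≤ 1) {n : ℕ} {G H : (ℕ → ℕ) → ℝ}
    (h : ∀ c, IsClusterVector n c → G c = H c) : clusterMean α n G = clusterMean α n H :=
  le_antisymm (clusterMean_mono h0 h1 fun c hc => (h c hc).le)
    (clusterMean_mono h0 h1 fun c hc => (h c hc).ge)

lemma clusterMean_linear (α : ℝ) {n : ℕ} (x y : ℝ) : ∀ (G H : (ℕ → ℕ) → ℝ),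
    clusterMean α n (fun c => x * G c + y * H c) =
      x * clusterMean α n G + y * clusterMean α n H := by
  induction n with
  | zero => exact fun _ _ => rfl
  | succ n ih =>
    intro G H
    simp only [clusterMean]
    rw [← ih]
    congr 1
    funext c
    simp only [clusterStep, Finset.mul_sum]
    rw [mul_add, mul_add, Finset.mul_sum, Finset.mul_sum, add_add_add_comm,
      ← Finset.sum_add_distrib]
    congr 1
    refine Finset.sum_congr rfl fun i _ => ?_
    ring

lemma hasDerivAt_clusterMean (α : ℝ) {n : ℕ} {t : ℝ} :
    ∀ {G : ℝ → (ℕ → ℕ) → ℝ} {G' : (ℕ → ℕ) → ℝ}, (∀ c, HasDerivAt (fun θ => G θ c) (G' c) t) →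
      HasDerivAt (fun θ => clusterMean α n (G θ)) (clusterMean α n G') t := by
  induction n with
  | zero => exact fun h => h 0
  | succ n ih =>
    intro G G' h
    refine ih (G := fun θ => clusterStep α n (G θ)) fun c => ?_
    refine (h _).add (HasDerivAt.const_mul _ (HasDerivAt.fun_sum fun i _ => ?_))
    exact ((h _).sub (h _)).const_mul _

lemma walkMean_linear (α : ℝ) {n : ℕ} (x y : ℂ) : ∀ (f g : ℤ → ℂ),
    walkMean α n (fun s => x * f s + y * g s) = x * walkMean α n f + y * walkMean α n g := by
  induction n with
  | zero => exact fun _ _ => rfl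
  | succ n ih =>
    intro f g
    simp only [walkMean]
    rw [← ih]
    congr 1
    funext s
    simp only [walkStep, Complex.real_smul]
    ring

lemma hasDerivAt_walkMean (α : ℝ) {n : ℕ} {t : ℝ} :
    ∀ {f : ℝ → ℤ → ℂ} {f' : ℤ → ℂ}, (∀ s, HasDerivAt (fun θ => f θ s) (f' s) t) →
      HasDerivAt (fun θ => walkMean α n (f θ)) (walkMean α n f') t := by
  induction n with
  | zero => exact fun h => h 0
  | succ n ih =>
    intro f f' h
    refine ih (f := fun θ => walkStep α n (f θ)) fun s => ?_
    exact ((h _).const_smul _).add ((h _).const_smul _)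

lemma prod_update_new {n : ℕ} {c : ℕ → ℕ} (h : ℕ → ℝ) :
    ∏ j ∈ Finset.range (n + 1), h (Function.update c n 1 j) =
      (∏ j ∈ Finset.range n, h (c j)) * h 1 := by
  rw [Finset.prod_range_succ, Function.update_self]
  congr 1
  refine Finset.prod_congr rfl fun i hi => ?_
  rw [Function.update_of_ne (Finset.mem_range.1 hi).ne]

lemma prod_update_join {n : ℕ} {c : ℕ → ℕ} (hc : IsClusterVector n c) (h : ℕ → ℝ) (h0 : h 0 = 1)
    {i : ℕ} (hi : i < n) :
    ∏ j ∈ Finset.range (n + 1), h (Function.update c i (c i + 1) j) =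
      (∏ j ∈ (Finset.range n).erase i, h (c j)) * h (c i + 1) := by
  rw [Finset.prod_range_succ, Function.update_of_ne hi.ne', hc.2 n le_rfl, h0, mul_one,
    ← Finset.prod_erase_mul _ _ (Finset.mem_range.2 hi), Function.update_self]
  congr 1
  refine Finset.prod_congr rfl fun j hj => ?_
  rw [Function.update_of_ne (Finset.ne_of_mem_erase hj)]

/-- The characteristic function `φ n` of the walk is the mean of the product of `cos (c i * θ)`
over the clusters, since the signs of the clusters are independent and fair. The proof avoids
signs: both sides satisfy `φ (n + 1) = cos θ * φ n + (α / n) * sin θ * deriv (φ n)`. -/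
theorem walkMean_exp_eq {α : ℝ} (h0 : 0 ≤ α) (h1 : α ≤ 1) (n : ℕ) (θ : ℝ) :
    walkMean α n (fun s : ℤ => Complex.exp ((θ * s : ℝ) * Complex.I)) =
      (clusterMean α n (fun c => ∏ i ∈ Finset.range n, Real.cos (c i * θ)) : ℝ) := by
  induction n generalizing θ with
  | zero => simp [walkMean, clusterMean]
  | succ n ih =>
    have hW : HasDerivAt
        (fun θ : ℝ => walkMean α n (fun s : ℤ => Complex.exp ((θ * s : ℝ) * Complex.I)))
        (walkMean α n (fun s : ℤ =>
          Complex.exp ((θ * s : ℝ) * Complex.I) * (s * Complex.I))) θ := by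
      refine hasDerivAt_walkMean α fun s => ?_
      have h := ((((hasDerivAt_id θ).mul_const (s : ℝ)).ofReal_comp).mul_const Complex.I).cexp
      simpa using h
    have hC : HasDerivAt
        (fun θ : ℝ => clusterMean α n (fun c => ∏ i ∈ Finset.range n, Real.cos (c i * θ)))
        (clusterMean α n (fun c => ∑ i ∈ Finset.range n,
          (∏ j ∈ (Finset.range n).erase i, Real.cos (c j * θ)) • (-Real.sin (c i * θ) * c i)))
        θ := by
      refine hasDerivAt_clusterMean α fun c => ?_
      refine HasDerivAt.fun_finsetProd fun i _ => ?_
      have h := ((hasDerivAt_id θ).const_mul (c i : ℝ)).cos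
      simpa using h
    have hD := hW.unique ((funext fun θ => ih θ) ▸ hC.ofReal_comp)
    have e1 : walkStep α n (fun s : ℤ => Complex.exp ((θ * s : ℝ) * Complex.I)) = fun s : ℤ =>
        Complex.cos θ * Complex.exp ((θ * s : ℝ) * Complex.I) +
          (α / n * Complex.sin θ) *
            (Complex.exp ((θ * s : ℝ) * Complex.I) * (s * Complex.I)) := by
      funext s
      have a1 : Complex.exp ((θ * (s + 1 : ℤ) : ℝ) * Complex.I) =
          Complex.exp ((θ * s : ℝ) * Complex.I) *
            (Complex.cos θ + Complex.sin θ * Complex.I) := by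
        rw [← Complex.exp_mul_I, ← Complex.exp_add]
        congr 1
        push_cast
        ring
      have a2 : Complex.exp ((θ * (s - 1 : ℤ) : ℝ) * Complex.I) =
          Complex.exp ((θ * s : ℝ) * Complex.I) *
            (Complex.cos θ - Complex.sin θ * Complex.I) := by
        rw [← Complex.cos_neg (θ : ℂ), sub_eq_add_neg (Complex.cos _), ← neg_mul,
          ← Complex.sin_neg, ← Complex.exp_mul_I, ← Complex.exp_add]
        congr 1
        push_cast
        ring
      simp only [walkStep, a1, a2, Complex.real_smul]
      push_cast
      ring
    have e2 : ∀ c, IsClusterVector n c →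
        clusterStep α n (fun c => ∏ i ∈ Finset.range (n + 1), Real.cos (c i * θ)) c =
          Real.cos θ * ∏ i ∈ Finset.range n, Real.cos (c i * θ) +
          (α / n * Real.sin θ) * ∑ i ∈ Finset.range n,
          (∏ j ∈ (Finset.range n).erase i, Real.cos (c j * θ)) • (-Real.sin (c i * θ) * c i) := by
      intro c hc
      simp only [clusterStep]
      rw [prod_update_new (fun k => Real.cos (k * θ))]
      congr 1
      · simp [mul_comm]
      rw [mul_assoc]
      congr 1
      rw [Finset.mul_sum]
      refine Finset.sum_congr rfl fun i hi => ?_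
      rw [prod_update_join hc (fun k => Real.cos (k * θ)) (by simp) (Finset.mem_range.1 hi),
        ← Finset.prod_erase_mul _ _ hi]
      push_cast
      rw [add_mul, Real.cos_add]
      simp only [one_mul, smul_eq_mul]
      ring
    rw [walkMean, e1, walkMean_linear, ih, hD, clusterMean,
      clusterMean_congr h0 h1 e2, clusterMean_linear]
    push_cast
    ring

/-! ### Exponential supermartingales of the cluster sizes -/

/-- If `g` is dominated by `g'` advanced by one step, then so are the multiplicative observables
`∏ exp (-g (c i))`, up to an explicit gain: the new cluster appears with probability at least
`1 - α` whatever the past, and contributes the factor `exp (-g' 1)`. -/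
lemma clusterMean_prod_exp_neg_succ_le {α : ℝ} (h0 : 0 ≤ α) (h1 : α ≤ 1) {n : ℕ} (hn : 1 ≤ n)
    {g g' : ℕ → ℝ} (hg' : g' 0 = 0)
    (h : ∀ c ≤ n, g c ≤ g' c + α * c / n * (1 - Real.exp (-(g' (c + 1) - g' c)))) :
    clusterMean α (n + 1) (fun c => ∏ i ∈ Finset.range (n + 1), Real.exp (-g' (c i))) ≤
      Real.exp (-((1 - α) * (1 - Real.exp (-g' 1)))) *
        clusterMean α n (fun c => ∏ i ∈ Finset.range n, Real.exp (-g (c i))) := by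
  have hlin := clusterMean_linear α (n := n) (Real.exp (-((1 - α) * (1 - Real.exp (-g' 1))))) 0
    (fun c => ∏ i ∈ Finset.range n, Real.exp (-g (c i))) 0
  simp only [zero_mul, add_zero] at hlin
  rw [← hlin, clusterMean]
  refine clusterMean_mono h0 h1 fun c hc => ?_
  have hn' : (n : ℝ) ≠ 0 := by positivity
  have e1 : clusterStep α n (fun c => ∏ i ∈ Finset.range (n + 1), Real.exp (-g' (c i))) c =
      (∏ i ∈ Finset.range n, Real.exp (-g' (c i))) * (1 + (-((1 - α) * (1 - Real.exp (-g' 1))) +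
        ∑ i ∈ Finset.range n, -(α * c i / n * (1 - Real.exp (-(g' (c i + 1) - g' (c i))))))) := by
    rw [clusterStep, prod_update_new (fun k => Real.exp (-g' k))]
    have e2 : ∀ i ∈ Finset.range n, (c i : ℝ) *
        (∏ j ∈ Finset.range (n + 1), Real.exp (-g' (Function.update c i (c i + 1) j)) -
          (∏ j ∈ Finset.range n, Real.exp (-g' (c j))) * Real.exp (-g' 1)) =
        (∏ j ∈ Finset.range n, Real.exp (-g' (c j))) *
          (c i * (1 - Real.exp (-g' 1)) -
            c i * (1 - Real.exp (-(g' (c i + 1) - g' (c i))))) := by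
      intro i hi
      rw [prod_update_join hc (fun k => Real.exp (-g' k)) (by simp [hg']) (Finset.mem_range.1 hi),
        ← Finset.prod_erase_mul _ _ hi]
      have e3 : Real.exp (-g' (c i + 1)) =
          Real.exp (-g' (c i)) * Real.exp (-(g' (c i + 1) - g' (c i))) := by
        rw [← Real.exp_add]; congr 1; ring
      rw [e3]
      ring
    rw [Finset.sum_congr rfl e2, ← Finset.mul_sum, Finset.sum_sub_distrib, ← Finset.sum_mul,
      hc.sum_cast]
    have e4 : ∑ i ∈ Finset.range n, -(α * c i / n * (1 - Real.exp (-(g' (c i + 1) - g' (c i))))) =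
        -(α / n * ∑ i ∈ Finset.range n, c i * (1 - Real.exp (-(g' (c i + 1) - g' (c i))))) := by
      rw [Finset.mul_sum, ← Finset.sum_neg_distrib]
      refine Finset.sum_congr rfl fun i _ => ?_
      ring
    rw [e4]
    field_simp
    ring
  rw [e1]
  have hpos : 0 ≤ ∏ i ∈ Finset.range n, Real.exp (-g' (c i)) :=
    Finset.prod_nonneg fun i _ => (Real.exp_pos _).le
  refine (mul_le_mul_of_nonneg_left ((add_comm _ _).trans_le (Real.add_one_le_exp _)) hpos).trans ?_
  rw [Real.exp_add, Real.exp_sum, mul_left_comm, ← Finset.prod_mul_distrib]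
  refine mul_le_mul_of_nonneg_left ?_ (Real.exp_pos _).le
  refine Finset.prod_le_prod (fun i _ => by positivity) fun i hi => ?_
  rw [← Real.exp_add]
  refine Real.exp_le_exp.2 ?_
  have := h (c i) (hc.le (Finset.mem_range.1 hi))
  linarith

/-- The barrier function of the cluster size: quadratic for sizes well below `a / b`, and cut off
to zero beyond. The rising factorials `c * (c + 1)` and `c * (c + 1) * (c + 2)` are eigenfunctions
of the growth of a cluster, with eigenvalues `1 + 2 * α / n` and `1 + 3 * α / n`. -/
noncomputable def barrier (a b : ℝ) (c : ℕ) : ℝ :=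
  max 0 (c * (c + 1) * (a - b * (c + 2)))

lemma barrier_nonneg (a b : ℝ) (c : ℕ) : 0 ≤ barrier a b c := le_max_left _ _

@[simp] lemma barrier_zero (a b : ℝ) : barrier a b 0 = 0 := by simp [barrier]

lemma mul_succ_le_of_lt {α a b : ℝ} (ha : 0 ≤ a) (hb : 0 < b) (hab : a ^ 3 ≤ (1 - α) * b ^ 2)
    {c : ℕ} (h : b * (c + 2) < a) : c * (c + 1) * a ≤ 1 - α := by
  have hc : (0 : ℝ) ≤ c := Nat.cast_nonneg c
  have h1 : (b * (c + 2)) ^ 2 ≤ a ^ 2 := pow_le_pow_left₀ (by positivity) h.le 2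
  have h2 : (c * (c + 1) * a) * b ^ 2 ≤ (b * (c + 2)) ^ 2 * a := by
    nlinarith [mul_nonneg ha (sq_nonneg b), mul_nonneg (mul_nonneg ha (sq_nonneg b)) hc]
  have h3 : (b * (c + 2)) ^ 2 * a ≤ a ^ 3 := by nlinarith
  have hb2 : 0 < b ^ 2 := by positivity
  nlinarith

/-- The barrier is a subsolution. The loss in `1 - exp (-x) ≥ x - x ^ 2` is cubic in the cluster
size, so it is absorbed by the cubic coefficient, through the term `4 * (α / m) * a' ^ 2`. -/
lemma barrier_le_step {α a b a' b' : ℝ} (h0 : 0 ≤ α) (h1 : α < 1) {m : ℕ} (hm : 1 ≤ m)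
    (ha' : 0 ≤ a') (hb' : 0 < b') (ha : a = a' * (1 + 2 * (α / m)))
    (hb : b' * (1 + 3 * (α / m)) + 4 * (α / m) * a' ^ 2 ≤ b)
    (hab : a' ^ 3 ≤ (1 - α) * b' ^ 2) {c : ℕ} (hcm : c ≤ m) :
    barrier a b c ≤ barrier a' b' c +
      α * c / m * (1 - Real.exp (-(barrier a' b' (c + 1) - barrier a' b' c))) := by
  rcases Nat.eq_zero_or_pos c with rfl | hc
  · simp
  have hm0 : (0 : ℝ) < m := by exact_mod_cast hm
  have hc1 : (1 : ℝ) ≤ c := by exact_mod_cast hc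
  have hx : 0 ≤ α / m := by positivity
  have hy0 : 0 ≤ α * c / m := by positivity
  have hy1 : α * c / m ≤ α := by
    rw [div_le_iff₀ hm0]
    exact mul_le_mul_of_nonneg_left (by exact_mod_cast hcm) h0
  have hq'' := barrier_nonneg a' b' (c + 1)
  rcases le_or_gt (c * (c + 1) * (a - b * (c + 2))) 0 with hP | hP
  · -- Here the barrier vanishes, and only the possible cut-off at the next size can hurt.
    rw [barrier, max_eq_left hP]
    set q := barrier a' b' c with hq
    have hq0 : 0 ≤ q := barrier_nonneg a' b' c
    have hq1 : q ≤ 1 - α := by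
      rw [hq, barrier]
      refine max_le (by linarith) ?_
      rcases le_or_gt a' (b' * (c + 2)) with h | h
      · have : c * (c + 1) * (a' - b' * (c + 2)) ≤ 0 :=
          mul_nonpos_of_nonneg_of_nonpos (by positivity) (by linarith)
        linarith
      · refine le_trans ?_ (mul_succ_le_of_lt ha' hb' hab h)
        refine mul_le_mul_of_nonneg_left ?_ (by positivity)
        have : 0 ≤ b' * (c + 2) := by positivity
        linarith
    have hq2 : q ≤ 1 := by linarith
    have he : Real.exp (-(barrier a' b' (c + 1) - q)) ≤ 1 + q + q ^ 2 := by
      have h2 := (abs_le.1 (Real.abs_exp_sub_one_sub_id_le (abs_le.2 ⟨by linarith, hq2⟩))).2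
      have h3 : Real.exp (-(barrier a' b' (c + 1) - q)) ≤ Real.exp q :=
        Real.exp_le_exp.2 (by linarith)
      linarith
    have h4 : -(α * (q + q ^ 2)) ≤
        α * c / m * (1 - Real.exp (-(barrier a' b' (c + 1) - q))) := by
      have : α * c / m * (q + q ^ 2) ≤ α * (q + q ^ 2) :=
        mul_le_mul_of_nonneg_right hy1 (by positivity)
      nlinarith
    nlinarith [mul_nonneg hq0 (sub_nonneg.2 hq1),
      mul_nonneg hq0 (mul_nonneg hq0 (sub_nonneg.2 h1.le))]
  · rw [barrier, max_eq_right hP.le]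
    have hlt : b * (c + 2) < a := by
      have := (mul_pos_iff_of_pos_left (by positivity : (0 : ℝ) < c * (c + 1))).1 hP
      linarith
    have hlt' : b' * (c + 2) < a' := by
      have h5 : b' * (1 + 2 * (α / m)) * (c + 2) < a' * (1 + 2 * (α / m)) := by
        rw [← ha]
        refine lt_of_le_of_lt (mul_le_mul_of_nonneg_right ?_ (by positivity)) hlt
        have : 0 ≤ b' * (α / m) := by positivity
        have : 0 ≤ 4 * (α / m) * a' ^ 2 := by positivity
        linarith
      have h6 : 0 < 1 + 2 * (α / m) := by positivity
      nlinarith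
    have hmul := mul_succ_le_of_lt ha' hb' hab hlt'
    have hP' : 0 ≤ c * (c + 1) * (a' - b' * (c + 2)) :=
      mul_nonneg (by positivity) (by linarith)
    have hbc : barrier a' b' c = c * (c + 1) * (a' - b' * (c + 2)) := max_eq_right hP'
    have hbc1 : (c + 1) * (c + 2) * (a' - b' * (c + 3)) ≤ barrier a' b' (c + 1) := by
      refine le_trans (le_of_eq ?_) (le_max_right _ _)
      push_cast
      ring
    set x := (c + 1) * (2 * a' - 3 * b' * (c + 2)) with hxdef
    have hxle : x ≤ barrier a' b' (c + 1) - barrier a' b' c := by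
      rw [hbc]
      refine le_trans (le_of_eq ?_) (sub_le_sub_right hbc1 _)
      rw [hxdef]; ring
    have hbpos : 0 < b' * (c + 2) := by positivity
    have hac : a' * (c + 1) ≤ 1 := by
      have : (c + 1) * a' ≤ c * (c + 1) * a' := by
        nlinarith [mul_nonneg ha' (by positivity : (0 : ℝ) ≤ c + 1)]
      linarith
    have hxlo : -(a' * (c + 1)) ≤ x := by
      rw [hxdef]; nlinarith [mul_nonneg (sub_nonneg.2 hlt'.le) (by positivity : (0 : ℝ) ≤ c + 1)]
    have hxhi : x ≤ 2 * (a' * (c + 1)) := by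
      rw [hxdef]; nlinarith [mul_nonneg hbpos.le (by positivity : (0 : ℝ) ≤ c + 1)]
    have hsq : x ^ 2 ≤ 4 * a' ^ 2 * (c + 1) ^ 2 := by
      have : 0 ≤ a' * (c + 1) := by positivity
      nlinarith
    have he : Real.exp (-x) ≤ 1 - x + x ^ 2 := by
      rcases le_or_gt x 1 with hx1 | hx1
      · have h2 := (abs_le.1 (Real.abs_exp_sub_one_sub_id_le (x := -x)
          (abs_le.2 ⟨by linarith only [hx1], by linarith only [hac, hxlo]⟩))).2
        rw [neg_sq] at h2
        linarith only [h2]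
      · have : Real.exp (-x) ≤ 1 := Real.exp_le_one_iff.2 (by linarith only [hx1])
        nlinarith only [this, hx1]
    have he' : x - 4 * a' ^ 2 * (c + 1) ^ 2 ≤
        1 - Real.exp (-(barrier a' b' (c + 1) - barrier a' b' c)) := by
      have : Real.exp (-(barrier a' b' (c + 1) - barrier a' b' c)) ≤ Real.exp (-x) :=
        Real.exp_le_exp.2 (by linarith)
      linarith
    refine le_trans ?_ (add_le_add_right (mul_le_mul_of_nonneg_left he' hy0) _)
    rw [hbc, ha, mul_div_right_comm]
    set y := α / m with hy
    have h7 : c * (c + 1) * (a' * (1 + 2 * y) - b * (c + 2)) ≤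
        c * (c + 1) * (a' * (1 + 2 * y) - (b' * (1 + 3 * y) + 4 * y * a' ^ 2) * (c + 2)) := by
      gcongr
    refine h7.trans ?_
    have h8 : 0 ≤ 4 * y * a' ^ 2 * c * (c + 1) := by positivity
    have h9 : c * (c + 1) * (a' - b' * (c + 2)) + y * c * (x - 4 * a' ^ 2 * (c + 1) ^ 2) -
        c * (c + 1) * (a' * (1 + 2 * y) - (b' * (1 + 3 * y) + 4 * y * a' ^ 2) * (c + 2)) =
        4 * y * a' ^ 2 * c * (c + 1) := by
      rw [hxdef]; ring
    linarith only [h8, h9]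

/-! ### Growth factors of clusters -/

/-- The factor by which the moment `c * (c + 1) ⋯ (c + r - 1)` of a cluster size grows on average
from time `m` to time `n`, where `x = r * α`. -/
noncomputable def growth (x : ℝ) (n m : ℕ) : ℝ := ∏ j ∈ Finset.Ico m n, (1 + x / j)

@[simp] lemma growth_self (x : ℝ) (n : ℕ) : growth x n n = 1 := by simp [growth]

lemma growth_eq_mul {x : ℝ} {n m : ℕ} (h : m < n) :
    growth x n m = (1 + x / m) * growth x n (m + 1) := by
  rw [growth, Finset.prod_eq_prod_Ico_succ_bot h, growth]

lemma one_le_growth {x : ℝ} (hx : 0 ≤ x) (n m : ℕ) : 1 ≤ growth x n m := by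
  refine Finset.one_le_prod fun j _ => ?_
  have : 0 ≤ x / j := by positivity
  linarith

lemma growth_two_mul_le {α : ℝ} (h0 : 0 ≤ α) (n m : ℕ) : growth (2 * α) n m ≤ growth α n m ^ 2 := by
  rw [growth, growth, ← Finset.prod_pow]
  refine Finset.prod_le_prod (fun j _ => by positivity) fun j _ => ?_
  have : 2 * α / j = 2 * (α / j) := by ring
  rw [this]
  nlinarith [sq_nonneg (α / j)]

lemma sq_growth_le {α : ℝ} (h0 : 0 ≤ α) (h1 : α ≤ 1) {n m : ℕ} (hm : 2 ≤ m) (hmn : m ≤ n) :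
    growth α n m ^ 2 ≤ 2 * growth (2 * α) n m := by
  -- Telescoping: `1 + 1 / j ^ 2 ≤ (j / (j - 1)) / ((j + 1) / j)`.
  have key : ∀ k, m ≤ k →
      growth α k m ^ 2 * ((m - 1) * k) ≤ growth (2 * α) k m * (m * (k - 1)) := by
    intro k hk
    induction k, hk using Nat.le_induction with
    | base => simp; linarith
    | succ k hk ih =>
      have hk2 : (2 : ℝ) ≤ k := by exact_mod_cast hm.trans hk
      have e : ∀ x, growth x (k + 1) m = growth x k m * (1 + x / k) := fun x => by
        rw [growth, Finset.prod_Ico_succ_top hk, growth]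
      rw [e, e]
      set A := growth (2 * α) k m
      set R := growth α k m
      have hA : 1 ≤ A := one_le_growth (by positivity) _ _
      have hα2 : α ^ 2 ≤ 1 := by nlinarith
      have hm0 : (0 : ℝ) < m := by positivity
      -- `(1 + α / k) ^ 2 * (k + 1) * (k - 1) ≤ (1 + 2 * α / k) * k * k`
      have h3 : (1 + α / k) ^ 2 * ((k + 1) * (k - 1)) ≤ (1 + 2 * α / k) * (k * k) := by
        have hk0 : (k : ℝ) ≠ 0 := by positivity
        have e1 : (1 + α / k) ^ 2 * ((k + 1) * (k - 1)) = (k + α) ^ 2 * (k ^ 2 - 1) / k ^ 2 := by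
          field_simp; ring
        have e2 : (1 + 2 * α / k) * (k * k) = (k ^ 2 + 2 * α * k) := by field_simp
        rw [e1, e2, div_le_iff₀ (by positivity)]
        nlinarith [mul_nonneg h0 (by positivity : (0 : ℝ) ≤ k), sq_nonneg α, sq_nonneg (k : ℝ),
          mul_nonneg (sub_nonneg.2 hα2) (sq_nonneg (k : ℝ))]
      have h4 : R ^ 2 * ((m - 1) * k) * ((1 + α / k) ^ 2 * ((k + 1) * (k - 1))) ≤
          A * (m * (k - 1)) * ((1 + 2 * α / k) * (k * k)) := by
        have hm1 : (1 : ℝ) ≤ m := by exact_mod_cast (by omega : 1 ≤ m)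
        refine mul_le_mul ih h3 ?_ ?_
        · have : (0 : ℝ) ≤ k - 1 := by linarith
          positivity
        · have : (0 : ℝ) ≤ k - 1 := by linarith
          positivity
      have h5 : (0 : ℝ) < k * (k - 1) := mul_pos (by linarith) (by linarith)
      push_cast
      refine le_of_mul_le_mul_right ?_ h5
      linarith
  have h := key n hmn
  have hm2 : (2 : ℝ) ≤ m := by exact_mod_cast hm
  have hn2 : (2 : ℝ) ≤ n := by exact_mod_cast hm.trans hmn
  set A := growth (2 * α) n m
  have hA : 1 ≤ A := one_le_growth (by positivity) _ _
  have h5 : (0 : ℝ) < (m - 1) * n := mul_pos (by linarith) (by linarith)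
  refine le_of_mul_le_mul_right (h.trans ?_) h5
  have : (m : ℝ) * (n - 1) ≤ 2 * ((m - 1) * n) := by nlinarith
  nlinarith

lemma rpow_le_growth {α : ℝ} (h0 : 0 ≤ α) (h1 : α ≤ 1) {n m : ℕ} (hm : 1 ≤ m) (hmn : m ≤ n) :
    ((n : ℝ) / m) ^ α ≤ growth α n m := by
  induction n, hmn using Nat.le_induction with
  | base =>
    have : (m : ℝ) ≠ 0 := by positivity
    simp [div_self this]
  | succ k hk ih =>
    have hk0 : (0 : ℝ) < k := by exact_mod_cast hm.trans hk
    have hm0 : (0 : ℝ) < m := by exact_mod_cast hm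
    have e : growth α (k + 1) m = growth α k m * (1 + α / k) := by
      rw [growth, Finset.prod_Ico_succ_top hk, growth]
    have e2 : (((k + 1 : ℕ) : ℝ) / m) = (k / m) * (1 + 1 / k) := by
      push_cast; field_simp
    rw [e, e2, Real.mul_rpow (by positivity) (by positivity)]
    have h2 : (1 + 1 / (k : ℝ)) ^ α ≤ 1 + α * (1 / k) :=
      rpow_one_add_le_one_add_mul_self (by linarith [one_div_pos.2 hk0]) h0 h1
    have h3 : 1 + α * (1 / (k : ℝ)) = 1 + α / k := by ring
    rw [h3] at h2
    exact mul_le_mul ih h2 (by positivity) (zero_le_one.trans (one_le_growth h0 _ _))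

lemma growth_le_rpow {α : ℝ} (h0 : 0 ≤ α) {n m : ℕ} (hm : 2 ≤ m) (hmn : m ≤ n) :
    growth α n m ≤ (((n : ℝ) - 1) / (m - 1)) ^ α := by
  have hm2 : (2 : ℝ) ≤ m := by exact_mod_cast hm
  induction n, hmn using Nat.le_induction with
  | base =>
    have : (m : ℝ) - 1 ≠ 0 := by linarith
    simp [div_self this]
  | succ k hk ih =>
    have hk2 : (2 : ℝ) ≤ k := by exact_mod_cast hm.trans hk
    have e : growth α (k + 1) m = growth α k m * (1 + α / k) := by
      rw [growth, Finset.prod_Ico_succ_top hk, growth]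
    have hk1 : (0 : ℝ) < k - 1 := by linarith
    have hm1 : (0 : ℝ) < m - 1 := by linarith
    have e2 : ((((k + 1 : ℕ) : ℝ) - 1) / (m - 1)) = ((k - 1) / (m - 1)) * (k / (k - 1)) := by
      push_cast; field_simp; ring
    rw [e, e2, Real.mul_rpow (by positivity) (by positivity)]
    refine mul_le_mul ih ?_ (by positivity) (by positivity)
    -- `1 + α / k ≤ exp (α / k)` and `1 / k ≤ log (k / (k - 1))`
    have h3 : (1 : ℝ) / k ≤ Real.log (k / (k - 1)) := by
      have := Real.one_sub_inv_le_log_of_pos (x := k / (k - 1)) (by positivity)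
      refine le_trans (le_of_eq ?_) this
      field_simp
      ring
    rw [Real.rpow_def_of_pos (by positivity)]
    have h4 := Real.add_one_le_exp (α / k)
    have h5 : Real.exp (α / k) ≤ Real.exp (Real.log (k / (k - 1)) * α) := by
      refine Real.exp_le_exp.2 ?_
      have := mul_le_mul_of_nonneg_right h3 h0
      refine le_trans (le_of_eq ?_) this
      ring
    linarith

/-! ### Bounds for the characteristic function -/

/-- The mean of the product of `|cos (c i * θ)|` over the clusters at time `n`, which bounds the
characteristic function of the walk at `θ`. -/
noncomputable def cosProdMean (α : ℝ) (n : ℕ) (θ : ℝ) : ℝ :=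
  clusterMean α n (fun c => ∏ i ∈ Finset.range n, |Real.cos (c i * θ)|)

lemma norm_walkMean_exp_le {α : ℝ} (h0 : 0 ≤ α) (h1 : α ≤ 1) (n : ℕ) (θ : ℝ) :
    ‖walkMean α n (fun s : ℤ => Complex.exp ((θ * s : ℝ) * Complex.I))‖ ≤ cosProdMean α n θ := by
  rw [walkMean_exp_eq h0 h1, Complex.norm_real, Real.norm_eq_abs, abs_le]
  have hlin := clusterMean_linear α (n := n) (-1) 0
    (fun c => ∏ i ∈ Finset.range n, |Real.cos (c i * θ)|) 0
  simp only [zero_mul, add_zero, neg_one_mul] at hlin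
  constructor
  · rw [cosProdMean, ← hlin]
    refine clusterMean_mono h0 h1 fun c _ => ?_
    rw [← Finset.abs_prod]
    exact neg_abs_le _
  · refine clusterMean_mono h0 h1 fun c _ => ?_
    rw [← Finset.abs_prod]
    exact le_abs_self _

lemma cosProdMean_congr {α : ℝ} (h0 : 0 ≤ α) (h1 : α ≤ 1) (n : ℕ) {θ θ' : ℝ}
    (h : ∀ k : ℕ, |Real.cos (k * θ)| = |Real.cos (k * θ')|) :
    cosProdMean α n θ = cosProdMean α n θ' :=
  clusterMean_congr h0 h1 fun _ _ => Finset.prod_congr rfl fun _ _ => h _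

/-- The master bound. The barrier with coefficients `s` and `κ + 4 * s ^ 2` at time `n` is carried
back to time `m`, where its coefficients are multiplied by growth factors; each time `m` in
`2, …, n` at which the barrier is positive at a cluster of size one contributes to the exponent. -/
theorem cosProdMean_le {α : ℝ} (h0 : 0 ≤ α) (h1 : α < 1) {n : ℕ} (hn : 1 ≤ n) {s κ θ : ℝ}
    (hs : 0 ≤ s) (hκ : 0 < κ) (hsκ : s ^ 3 ≤ (1 - α) * κ ^ 2)
    (hcos : ∀ c : ℕ, |Real.cos (c * θ)| ≤ Real.exp (-barrier s (κ + 4 * s ^ 2) c))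
    {T : Finset ℕ} (hT : ∀ m ∈ T, 2 ≤ m ∧ m ≤ n) {y : ℕ → ℝ} (hy0 : ∀ m ∈ T, 0 ≤ y m)
    (hy1 : ∀ m ∈ T, y m ≤ 1 / 2)
    (hy : ∀ m ∈ T, y m ≤ 2 * (s * growth (2 * α) n m -
      3 * (growth α n m ^ 3 * (κ + 4 * s ^ 2 * growth α n m)))) :
    cosProdMean α n θ ≤ Real.exp (-((1 - α) / 2 * ∑ m ∈ T, y m)) := by
  set A : ℕ → ℝ := fun m => s * growth (2 * α) n m with hA
  set B : ℕ → ℝ := fun m => growth α n m ^ 3 * (κ + 4 * s ^ 2 * growth α n m) with hB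
  have hstep : ∀ m, 1 ≤ m → m ≤ n →
      clusterMean α m (fun c => ∏ i ∈ Finset.range m, Real.exp (-barrier (A m) (B m) (c i))) ≤
        Real.exp (-((1 - α) * ∑ j ∈ Finset.Icc 2 m, (1 - Real.exp (-barrier (A j) (B j) 1)))) := by
    intro m hm
    induction m, hm using Nat.le_induction with
    | base =>
      intro _
      simp [clusterMean, clusterStep, barrier_nonneg]
    | succ m hm ih =>
      intro hmn
      have hR := growth_eq_mul (x := α) (n := n) (m := m) hmn
      have hA' := growth_eq_mul (x := 2 * α) (n := n) (m := m) hmn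
      have hx : 0 ≤ α / m := by positivity
      have hR1 := one_le_growth h0 n (m + 1)
      have hA1 := one_le_growth (by positivity : 0 ≤ 2 * α) n (m + 1)
      have hle := growth_two_mul_le h0 n (m + 1)
      refine (clusterMean_prod_exp_neg_succ_le h0 h1.le hm (g := barrier (A m) (B m))
        (barrier_zero _ _) fun c hc => ?_).trans ?_
      · refine barrier_le_step h0 h1 hm (mul_nonneg hs (by linarith)) ?_ ?_ ?_ ?_ hc
        · simp only [hB]
          positivity
        · simp only [hA, hA']
          ring
        · simp only [hB, hR]
          set x := α / m
          set R := growth α n (m + 1)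
          set G := growth (2 * α) n (m + 1)
          have e1 : G ^ 2 ≤ R ^ 4 := by nlinarith
          have e2 : 0 ≤ R ^ 3 := by positivity
          have e3 : 1 + 3 * x ≤ (1 + x) ^ 3 := by nlinarith [mul_nonneg hx (sq_nonneg x)]
          have e4 : 1 + 4 * x ≤ (1 + x) ^ 4 := by
            nlinarith [mul_nonneg hx (sq_nonneg x), sq_nonneg (x ^ 2)]
          calc R ^ 3 * (κ + 4 * s ^ 2 * R) * (1 + 3 * x) + 4 * x * (s * G) ^ 2
              = κ * R ^ 3 * (1 + 3 * x) + 4 * s ^ 2 * (R ^ 4 * (1 + 3 * x) + x * G ^ 2) := by ring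
            _ ≤ κ * R ^ 3 * (1 + 3 * x) + 4 * s ^ 2 * (R ^ 4 * (1 + 3 * x) + x * R ^ 4) := by gcongr
            _ = κ * R ^ 3 * (1 + 3 * x) + 4 * s ^ 2 * (R ^ 4 * (1 + 4 * x)) := by ring
            _ ≤ κ * R ^ 3 * (1 + x) ^ 3 + 4 * s ^ 2 * (R ^ 4 * (1 + x) ^ 4) := by gcongr
            _ = ((1 + x) * R) ^ 3 * (κ + 4 * s ^ 2 * ((1 + x) * R)) := by ring
        · simp only [hB]
          set R := growth α n (m + 1)
          set G := growth (2 * α) n (m + 1)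
          have h1' : 0 ≤ 1 - α := by linarith
          calc (s * G) ^ 3 = s ^ 3 * G ^ 3 := by ring
            _ ≤ ((1 - α) * κ ^ 2) * (R ^ 2) ^ 3 := by gcongr
            _ = (1 - α) * (R ^ 3 * κ) ^ 2 := by ring
            _ ≤ (1 - α) * (R ^ 3 * (κ + 4 * s ^ 2 * R)) ^ 2 := by
              gcongr
              have : 0 ≤ 4 * s ^ 2 * R := by positivity
              linarith
      · refine (mul_le_mul_of_nonneg_left (ih (by omega)) (Real.exp_pos _).le).trans ?_
        rw [← Real.exp_add, ← Finset.insert_Icc_right_eq_Icc_add_one (by omega),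
          Finset.sum_insert (by simp)]
        refine Real.exp_le_exp.2 (le_of_eq ?_)
        ring
  have hAn : A n = s := by simp [hA]
  have hBn : B n = κ + 4 * s ^ 2 := by simp [hB]
  have hmain := hstep n hn le_rfl
  rw [hAn, hBn] at hmain
  refine le_trans (clusterMean_mono h0 h1.le fun c _ => ?_) (hmain.trans ?_)
  · exact Finset.prod_le_prod (fun _ _ => abs_nonneg _) fun i _ => hcos (c i)
  · refine Real.exp_le_exp.2 (neg_le_neg ?_)
    rw [div_mul_eq_mul_div, mul_div_assoc]
    refine mul_le_mul_of_nonneg_left ?_ (by linarith)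
    rw [Finset.sum_div]
    refine le_trans (Finset.sum_le_sum fun m hm => ?_)
      (Finset.sum_le_sum_of_subset_of_nonneg (t := Finset.Icc 2 n) (s := T)
        (fun m hm => Finset.mem_Icc.2 (hT m hm)) fun j _ _ => ?_)
    · have e1 : y m ≤ barrier (A m) (B m) 1 := by
        refine (hy m hm).trans (le_trans (le_of_eq ?_) (le_max_right _ _))
        simp only [hA, hB]
        push_cast
        ring
      have e2 : Real.exp (-barrier (A m) (B m) 1) ≤ Real.exp (-y m) :=
        Real.exp_le_exp.2 (by linarith)
      have e3 := (abs_le.1 (Real.abs_exp_sub_one_sub_id_le (x := -y m)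
        (abs_le.2 ⟨by linarith [hy1 m hm], by linarith [hy0 m hm]⟩))).2
      nlinarith [hy0 m hm, hy1 m hm]
    · have : Real.exp (-barrier (A j) (B j) 1) ≤ 1 :=
        Real.exp_le_one_iff.2 (neg_nonpos.2 (barrier_nonneg _ _ _))
      linarith

lemma abs_cos_le_exp_neg {x : ℝ} (hx : |x| ≤ Real.pi / 2) :
    |Real.cos x| ≤ Real.exp (-(x ^ 2 / 5)) := by
  have h1 := abs_le.1 hx
  rw [abs_of_nonneg (Real.cos_nonneg_of_neg_pi_div_two_le_of_le (by linarith) (by linarith))]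
  have h2 : Real.cos x ≤ 1 - 2 / Real.pi ^ 2 * x ^ 2 :=
    Real.cos_le_one_sub_mul_cos_sq (hx.trans (by linarith [Real.pi_pos]))
  have h3 : 1 / 5 ≤ 2 / Real.pi ^ 2 := by
    rw [div_le_div_iff₀ (by norm_num) (by positivity)]
    nlinarith [Real.pi_lt_d2, Real.pi_pos]
  have h4 := Real.add_one_le_exp (-(x ^ 2 / 5))
  nlinarith [sq_nonneg x]

/-- For small `θ`: every time `m` at which a new cluster has typical final size at most of order
`1 / θ` contributes the square of `θ` times that size. -/
lemma cosProdMean_le_of_growth_le {α : ℝ} (h0 : 0 ≤ α) (h1 : α < 1) {n : ℕ} (hn : 1 ≤ n) {θ : ℝ}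
    (hθ : 0 < θ) {T : Finset ℕ} (hT : ∀ m ∈ T, 2 ≤ m ∧ m ≤ n)
    (hTθ : ∀ m ∈ T, θ * growth α n m ≤ (1 - α) / 240) :
    cosProdMean α n θ ≤
      Real.exp (-((1 - α) ^ 2 / 40 * ∑ m ∈ T, θ ^ 2 * growth α n m ^ 2)) := by
  set a := (1 - α) / 10 with ha
  have ha0 : 0 < a := by rw [ha]; linarith
  have ha1 : a ≤ 1 / 10 := by rw [ha]; linarith
  refine (cosProdMean_le h0 h1 hn (s := a * θ ^ 2) (κ := θ ^ 3)
    (y := fun m => a / 2 * (θ ^ 2 * growth α n m ^ 2)) (by positivity) (by positivity)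
    ?_ ?_ hT (fun m _ => by positivity) ?_ ?_).trans (le_of_eq ?_)
  · have : a ^ 3 ≤ 10 * a := by nlinarith [mul_pos ha0 ha0]
    have e : 1 - α = 10 * a := by rw [ha]; ring
    rw [e]
    calc (a * θ ^ 2) ^ 3 = a ^ 3 * (θ ^ 3) ^ 2 := by ring
      _ ≤ _ := by gcongr
  · intro c
    rcases le_or_gt (a * θ ^ 2) ((θ ^ 3 + 4 * (a * θ ^ 2) ^ 2) * (c + 2)) with h | h
    · have : barrier (a * θ ^ 2) (θ ^ 3 + 4 * (a * θ ^ 2) ^ 2) c = 0 :=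
        max_eq_left (mul_nonpos_of_nonneg_of_nonpos (by positivity) (by linarith))
      rw [this, neg_zero, Real.exp_zero]
      exact Real.abs_cos_le_one _
    · have h2 : θ ^ 2 * (θ * (c + 2)) < θ ^ 2 * a := by
        have : 0 ≤ 4 * (a * θ ^ 2) ^ 2 * (c + 2) := by positivity
        nlinarith
      have h3 : θ * (c + 2) < a := lt_of_mul_lt_mul_left h2 (by positivity)
      have h4 : |(c : ℝ) * θ| ≤ Real.pi / 2 := by
        rw [abs_of_nonneg (by positivity)]
        have := Real.pi_gt_three
        nlinarith
      refine (abs_cos_le_exp_neg h4).trans (Real.exp_le_exp.2 (neg_le_neg ?_))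
      refine max_le (by positivity) ?_
      have h5 : a * θ ^ 2 - (θ ^ 3 + 4 * (a * θ ^ 2) ^ 2) * (c + 2) ≤ a * θ ^ 2 := by
        have : 0 ≤ (θ ^ 3 + 4 * (a * θ ^ 2) ^ 2) * ((c : ℝ) + 2) := by positivity
        linarith
      have h6 : (c : ℝ) * (c + 1) ≤ 2 * c ^ 2 := by
        have : c ≤ c ^ 2 := Nat.le_self_pow (by norm_num) c
        have : (c : ℝ) ≤ c ^ 2 := by exact_mod_cast this
        nlinarith
      calc (c : ℝ) * (c + 1) * (a * θ ^ 2 - (θ ^ 3 + 4 * (a * θ ^ 2) ^ 2) * (c + 2))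
          ≤ c * (c + 1) * (a * θ ^ 2) := by gcongr
        _ ≤ 2 * c ^ 2 * (1 / 10 * θ ^ 2) := by gcongr
        _ = (c * θ) ^ 2 / 5 := by ring
  · intro m hm
    have h2 := hTθ m hm
    have h3 : 0 ≤ θ * growth α n m := mul_nonneg hθ.le (zero_le_one.trans (one_le_growth h0 _ _))
    have h4 : (θ * growth α n m) ^ 2 ≤ 1 := by
      have : θ * growth α n m ≤ 1 := by linarith
      nlinarith
    rw [← mul_pow]
    nlinarith
  · intro m hm
    have h2 := hTθ m hm
    have hR1 := one_le_growth h0 n m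
    have hG := sq_growth_le h0 h1.le (hT m hm).1 (hT m hm).2
    set R := growth α n m
    have h5 : R ^ 3 * (θ ^ 3 + 4 * (a * θ ^ 2) ^ 2 * R) ≤ 2 * (a / 24) * (θ ^ 2 * R ^ 2) := by
      have e : R ^ 3 * (θ ^ 3 + 4 * (a * θ ^ 2) ^ 2 * R) =
          (θ * R) * (1 + 4 * a ^ 2 * (θ * R)) * (θ ^ 2 * R ^ 2) := by ring
      rw [e]
      refine mul_le_mul_of_nonneg_right ?_ (by positivity)
      have e1 : 0 ≤ θ * R := by positivity
      have e2 : θ * R ≤ a / 24 := by rw [ha]; linarith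
      have e3 : 4 * a ^ 2 * (θ * R) ≤ 1 := by nlinarith
      nlinarith
    have h6 : a * θ ^ 2 * R ^ 2 ≤ a * θ ^ 2 * (2 * growth (2 * α) n m) := by gcongr
    linarith
  · congr 2
    rw [← Finset.mul_sum, ha]
    ring

/-- For `θ` bounded away from `0`, clusters of size one suffice; they make the characteristic
function exponentially small. -/
lemma cosProdMean_le_of_le {α : ℝ} (h0 : 0 ≤ α) (h1 : α < 1) {n : ℕ} (hn : 1 ≤ n) {θ δ : ℝ}
    (hδ0 : 0 < δ) (hδ1 : δ ≤ 1) (hδθ : δ ≤ θ) (hθ : θ ≤ Real.pi / 2) {T : Finset ℕ}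
    (hT : ∀ m ∈ T, 2 ≤ m ∧ m ≤ n) (hTR : ∀ m ∈ T, growth α n m ^ 4 ≤ 7 / 6) :
    cosProdMean α n θ ≤ Real.exp (-((1 - α) ^ 2 * δ ^ 2 / 800 * T.card)) := by
  set s := (1 - α) * δ ^ 2 / 100 with hs
  have hδ2 : δ ^ 2 ≤ 1 := by nlinarith
  have h1' : 0 < 1 - α := by linarith
  have hs0 : 0 < s := by positivity
  have hs1 : s ≤ (1 - α) / 100 := by rw [hs]; nlinarith
  have hs2 : s ≤ δ ^ 2 / 100 := by rw [hs]; nlinarith [sq_nonneg δ]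
  have hκ : s / 8 ≤ s / 4 - 4 * s ^ 2 := by nlinarith
  refine (cosProdMean_le h0 h1 hn (s := s) (κ := s / 4 - 4 * s ^ 2)
    (y := fun _ => s / 4) hs0.le (by linarith)
    ?_ ?_ hT (fun m _ => by positivity) (fun m _ => by linarith) ?_).trans (le_of_eq ?_)
  · have : (s / 8) ^ 2 ≤ (s / 4 - 4 * s ^ 2) ^ 2 := pow_le_pow_left₀ (by positivity) hκ 2
    calc s ^ 3 = (64 * s) * (s / 8) ^ 2 := by ring
      _ ≤ (1 - α) * (s / 4 - 4 * s ^ 2) ^ 2 := by gcongr; linarith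
  · intro c
    rw [sub_add_cancel]
    rcases (by omega : c = 0 ∨ c = 1 ∨ 2 ≤ c) with rfl | rfl | hc
    · simp
    · rw [Nat.cast_one, one_mul]
      refine (abs_cos_le_exp_neg (by rwa [abs_of_nonneg (by linarith)])).trans
        (Real.exp_le_exp.2 (neg_le_neg (max_le (by positivity) ?_)))
      push_cast
      have : δ ^ 2 ≤ θ ^ 2 := pow_le_pow_left₀ hδ0.le hδθ 2
      nlinarith
    · have hc2 : (2 : ℝ) ≤ c := by exact_mod_cast hc
      have : barrier s (s / 4) c = 0 :=
        max_eq_left (mul_nonpos_of_nonneg_of_nonpos (by positivity) (by nlinarith))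
      rw [this, neg_zero, Real.exp_zero]
      exact Real.abs_cos_le_one _
  · intro m hm
    have hR := hTR m hm
    have hR1 := one_le_growth h0 n m
    have hG1 := one_le_growth (by positivity : 0 ≤ 2 * α) n m
    set R := growth α n m
    have h2 : R ^ 3 * (s / 4 - 4 * s ^ 2 + 4 * s ^ 2 * R) ≤ R ^ 4 * (s / 4) := by
      have e : R ^ 3 * (s / 4 - 4 * s ^ 2) * 1 ≤ R ^ 3 * (s / 4 - 4 * s ^ 2) * R :=
        mul_le_mul_of_nonneg_left hR1 (mul_nonneg (by positivity) (by linarith))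
      nlinarith
    have h3 : R ^ 4 * (s / 4) ≤ 7 / 6 * (s / 4) := by gcongr
    have h4 : s ≤ s * growth (2 * α) n m := le_mul_of_one_le_right hs0.le hG1
    linarith
  · congr 2
    rw [Finset.sum_const, nsmul_eq_mul, hs]
    ring

/-! ### Decay of the characteristic function in the three regimes -/

lemma growth_le_two_mul_div_rpow {α : ℝ} (h0 : 0 ≤ α) {n m : ℕ} (hm : 2 ≤ m) (hmn : m ≤ n) :
    growth α n m ≤ (2 * n / m) ^ α := by
  refine (growth_le_rpow h0 hm hmn).trans ?_
  have hm2 : (2 : ℝ) ≤ m := by exact_mod_cast hm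
  have hmn' : (m : ℝ) ≤ n := by exact_mod_cast hmn
  have h1 : (0 : ℝ) < m - 1 := by linarith
  refine Real.rpow_le_rpow (div_nonneg (by linarith) h1.le) ?_ h0
  rw [div_le_div_iff₀ h1 (by linarith)]
  nlinarith

/-- The diffusive bound, valid for every reinforcement parameter: it only uses the clusters founded
during a final positive fraction of the time. -/
lemma exists_cosProdMean_le_sq {α : ℝ} (h0 : 0 ≤ α) (h1 : α < 1) : ∃ c : ℝ, 0 < c ∧
    ∀ n : ℕ, 2 ≤ n → ∀ θ : ℝ, 0 < θ → θ ≤ Real.pi / 2 →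
      cosProdMean α n θ ≤ Real.exp (-(c * (n * θ ^ 2))) := by
  set δ := (1 - α) / 480 with hδ
  have hδ0 : 0 < δ := by rw [hδ]; linarith
  have hδ1 : δ ≤ 1 := by rw [hδ]; linarith
  refine ⟨(1 - α) ^ 2 * δ ^ 2 / (800 * 240), by have : 0 < 1 - α := by linarith
                                                positivity, fun n hn θ hθ0 hθ1 => ?_⟩
  set T := Finset.Icc (n - n / 60) n with hTdef
  have hT : ∀ m ∈ T, 2 ≤ m ∧ m ≤ n := fun m hm => by
    rw [hTdef, Finset.mem_Icc] at hm
    omega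
  have hcard : (n : ℝ) / 60 ≤ T.card := by
    have h : n ≤ 60 * T.card := by
      rw [hTdef, Nat.card_Icc]; omega
    have : (n : ℝ) ≤ 60 * T.card := by exact_mod_cast h
    linarith
  have hR : ∀ m ∈ T, growth α n m ≤ 1.035 := fun m hm => by
    have hm' := hT m hm
    have hmlow : 59 * n ≤ 60 * m := by
      rw [hTdef, Finset.mem_Icc] at hm; omega
    have hmlow' : 59 * (n : ℝ) ≤ 60 * m := by exact_mod_cast hmlow
    have hm2 : (2 : ℝ) ≤ m := by exact_mod_cast hm'.1
    have hmn : (m : ℝ) ≤ n := by exact_mod_cast hm'.2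
    have hm1 : (0 : ℝ) < m - 1 := by linarith
    refine (growth_le_rpow h0 hm'.1 hm'.2).trans ?_
    refine (Real.rpow_le_rpow_of_exponent_le ((one_le_div hm1).2 (by linarith)) h1.le).trans ?_
    rw [Real.rpow_one, div_le_iff₀ hm1]
    have hn2 : (2 : ℝ) ≤ n := by exact_mod_cast hn
    norm_num
    linarith
  have hR1 : ∀ m, 1 ≤ growth α n m := one_le_growth h0 n
  have hα2 : 0 < (1 - α) ^ 2 := by have : 0 < 1 - α := by linarith
                                   positivity
  rcases le_or_gt θ δ with h | h
  · refine (cosProdMean_le_of_growth_le h0 h1 (by omega) hθ0 hT fun m hm => ?_).trans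
      (Real.exp_le_exp.2 (neg_le_neg ?_))
    · have := hR m hm
      have : θ * growth α n m ≤ δ * 1.035 := mul_le_mul h this (by linarith [hR1 m]) hδ0.le
      rw [hδ] at this
      linarith
    · have e1 : θ ^ 2 * (n / 60) ≤ ∑ m ∈ T, θ ^ 2 * growth α n m ^ 2 := by
        calc θ ^ 2 * (n / 60) ≤ θ ^ 2 * T.card := by gcongr
          _ = ∑ m ∈ T, θ ^ 2 * 1 := by rw [Finset.sum_const, nsmul_eq_mul]; ring
          _ ≤ _ := by
            gcongr with m hm
            exact one_le_pow₀ (hR1 m)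
      have e2 : (1 - α) ^ 2 * δ ^ 2 / (800 * 240) ≤ (1 - α) ^ 2 / 40 * (1 / 60) := by
        have : δ ^ 2 ≤ 1 := by nlinarith
        nlinarith
      calc (1 - α) ^ 2 * δ ^ 2 / (800 * 240) * (n * θ ^ 2)
          ≤ (1 - α) ^ 2 / 40 * (1 / 60) * (n * θ ^ 2) := by gcongr
        _ = (1 - α) ^ 2 / 40 * (θ ^ 2 * (n / 60)) := by ring
        _ ≤ _ := by gcongr
  · refine (cosProdMean_le_of_le h0 h1 (by omega) hδ0 hδ1 h.le hθ1 hT fun m hm => ?_).trans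
      (Real.exp_le_exp.2 (neg_le_neg ?_))
    · calc growth α n m ^ 4 ≤ 1.035 ^ 4 :=
            pow_le_pow_left₀ (zero_le_one.trans (hR1 m)) (hR m hm) 4
        _ ≤ 7 / 6 := by norm_num
    · have h2 : θ ^ 2 ≤ 4 := by nlinarith [Real.pi_lt_four]
      calc (1 - α) ^ 2 * δ ^ 2 / (800 * 240) * (n * θ ^ 2)
          ≤ (1 - α) ^ 2 * δ ^ 2 / (800 * 240) * (n * 4) := by gcongr
        _ = (1 - α) ^ 2 * δ ^ 2 / 800 * (n / 60) := by ring
        _ ≤ _ := by gcongr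

lemma log_div_le_sum_Icc_inv {a n : ℕ} (ha : 1 ≤ a) (han : a ≤ n + 1) :
    Real.log ((n + 1) / a) ≤ ∑ m ∈ Finset.Icc a n, 1 / (m : ℝ) := by
  induction n with
  | zero =>
    have : a = 1 := by omega
    subst this
    simp
  | succ n ih =>
    rcases Nat.lt_or_ge (n + 1) a with h | h
    · have : a = n + 2 := by omega
      subst this
      rw [Finset.Icc_eq_empty (by omega)]
      push_cast
      rw [add_assoc, one_add_one_eq_two, div_self (by positivity)]
      simp
    · have ha0 : (0 : ℝ) < a := by exact_mod_cast ha
      rw [← Finset.insert_Icc_right_eq_Icc_add_one (by omega), Finset.sum_insert (by simp)]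
      have e : (((n + 1 : ℕ) : ℝ) + 1) / a = ((n + 1) / a) * (1 + 1 / (n + 1)) := by
        push_cast; field_simp
      rw [e, Real.log_mul (by positivity) (by positivity), add_comm]
      have h2 := Real.log_le_sub_one_of_pos (x := 1 + 1 / ((n : ℝ) + 1)) (by positivity)
      have h3 := ih h
      push_cast
      linarith

/-- In the critical case the times `m ≥ n * θ` all contribute, with weight `1 / m`; this is the
source of the logarithm. -/
lemma exists_cosProdMean_half_le : ∃ c θ₀ : ℝ, 0 < c ∧ 0 < θ₀ ∧
    ∀ n : ℕ, ∀ θ : ℝ, 0 < θ → θ ≤ θ₀ → 2 ≤ n * θ →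
      cosProdMean (1 / 2) n θ ≤ Real.exp (-(c * (n * θ ^ 2 * Real.log (1 / θ)))) := by
  refine ⟨1 / 320, 1 / 2 * (1 / 480) ^ 2, by norm_num, by norm_num, fun n θ hθ0 hθ1 hnθ => ?_⟩
  have hn0 : (0 : ℝ) < n := by
    by_contra h
    nlinarith
  have hn1 : 1 ≤ n := by exact_mod_cast hn0
  have hθ4 : θ ≤ 1 / 4 := hθ1.trans (by norm_num)
  set a := ⌈n * θ⌉₊ with ha
  have ha2 : 2 ≤ a := by
    have : (2 : ℝ) ≤ a := hnθ.trans (Nat.le_ceil _)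
    exact_mod_cast this
  have haup : (a : ℝ) ≤ 2 * (n * θ) := by
    have := (Nat.ceil_lt_add_one (by positivity : 0 ≤ n * θ)).le
    linarith
  have han : a ≤ n := by
    have : (a : ℝ) ≤ n := by nlinarith
    exact_mod_cast this
  have hT : ∀ m ∈ Finset.Icc a n, 2 ≤ m ∧ m ≤ n := fun m hm => by
    rw [Finset.mem_Icc] at hm
    omega
  refine (cosProdMean_le_of_growth_le (by norm_num) (by norm_num) hn1 hθ0 hT fun m hm => ?_).trans
    (Real.exp_le_exp.2 (neg_le_neg ?_))
  · have hm' := hT m hm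
    have hm0 : (0 : ℝ) < m := by exact_mod_cast (by omega : 0 < m)
    have hma : n * θ ≤ m := (Nat.le_ceil _).trans (by exact_mod_cast (Finset.mem_Icc.1 hm).1)
    have h2 := growth_le_two_mul_div_rpow (α := 1 / 2) (by norm_num) hm'.1 hm'.2
    have h3 : (2 * (n : ℝ) / m) ^ (1 / 2 : ℝ) ≤ (2 / θ) ^ (1 / 2 : ℝ) := by
      refine Real.rpow_le_rpow (by positivity) ?_ (by norm_num)
      rw [div_le_div_iff₀ hm0 hθ0]
      linarith
    rw [← Real.sqrt_eq_rpow (2 / θ)] at h3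
    have h4 : θ * growth (1 / 2) n m ≤ θ * Real.sqrt (2 / θ) := by
      gcongr
      exact h2.trans h3
    refine h4.trans (abs_le_of_sq_le_sq' ?_ (by norm_num)).2
    rw [mul_pow, Real.sq_sqrt (by positivity)]
    have : θ ^ 2 * (2 / θ) = 2 * θ := by field_simp
    rw [this]
    norm_num at hθ1 ⊢
    linarith
  · have e1 : ∀ m ∈ Finset.Icc a n, θ ^ 2 * n * (1 / m) ≤ θ ^ 2 * growth (1 / 2) n m ^ 2 := by
      intro m hm
      have hm' := hT m hm
      have h2 := rpow_le_growth (α := 1 / 2) (by norm_num) (by norm_num) (by omega : 1 ≤ m) hm'.2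
      rw [← Real.sqrt_eq_rpow] at h2
      have h3 := pow_le_pow_left₀ (Real.sqrt_nonneg _) h2 2
      rw [Real.sq_sqrt (by positivity)] at h3
      calc θ ^ 2 * n * (1 / m) = θ ^ 2 * (n / m) := by ring
        _ ≤ _ := by gcongr
    have e2 := Finset.sum_le_sum e1
    rw [← Finset.mul_sum] at e2
    have e3 := log_div_le_sum_Icc_inv (a := a) (n := n) (by omega) (by omega)
    have ha0 : (0 : ℝ) < a := by exact_mod_cast (by omega : 0 < a)
    have e4 : Real.log (1 / θ) / 2 ≤ Real.log ((n + 1) / a) := by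
      rw [div_eq_inv_mul, ← Real.log_rpow (by positivity)]
      refine Real.log_le_log (by positivity) ?_
      have h5 : (1 : ℝ) / (2 * θ) ≤ (n + 1) / a := by
        rw [div_le_div_iff₀ (by positivity) ha0]
        nlinarith
      refine le_trans ?_ h5
      rw [← one_div, ← Real.sqrt_eq_rpow]
      refine Real.sqrt_le_iff.2 ⟨by positivity, ?_⟩
      rw [div_pow, div_le_div_iff₀ hθ0 (by positivity)]
      nlinarith
    have e5 : 0 ≤ θ ^ 2 * n := by positivity
    calc 1 / 320 * (n * θ ^ 2 * Real.log (1 / θ))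
        = (1 - 1 / 2) ^ 2 / 40 * (θ ^ 2 * n * (Real.log (1 / θ) / 2)) := by ring
      _ ≤ (1 - 1 / 2) ^ 2 / 40 * (θ ^ 2 * n * ∑ m ∈ Finset.Icc a n, 1 / (m : ℝ)) := by
        gcongr
        exact e4.trans e3
      _ ≤ _ := by gcongr

/-- The superdiffusive bound: the clusters founded at times of order `n * θ ^ (1 / α)` reach
sizes of order `1 / θ`, and there are that many of them. -/
lemma exists_cosProdMean_le_rpow {α : ℝ} (h0 : 0 < α) (h1 : α < 1) : ∃ c θ₀ : ℝ, 0 < c ∧ 0 < θ₀ ∧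
    ∀ n : ℕ, ∀ θ : ℝ, 0 < θ → θ ≤ θ₀ → 1 ≤ n * θ ^ (1 / α) →
      cosProdMean α n θ ≤ Real.exp (-(c * (n * θ ^ (1 / α)))) := by
  set δ := (1 - α) / 240 with hδ
  have hδ0 : 0 < δ := by rw [hδ]; linarith
  have hδ1 : δ ≤ 1 := by rw [hδ]; linarith
  have h1' : 0 < 1 - α := by linarith
  have hα1 : 1 ≤ 1 / α := by rw [le_div_iff₀ h0]; linarith
  refine ⟨(1 - α) ^ 2 / 40 * (δ ^ 2 / 16), δ / 4, by positivity, by positivity,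
    fun n θ hθ0 hθ1 hnθ => ?_⟩
  have hn0 : (0 : ℝ) < n := by
    have : 0 < θ ^ (1 / α) := by positivity
    by_contra h
    nlinarith
  have hn1 : 1 ≤ n := by exact_mod_cast hn0
  set q := (θ / δ) ^ (1 / α) with hq
  have hq0 : 0 < q := by positivity
  have hqα : q ^ α = θ / δ := by
    rw [hq, ← Real.rpow_mul (by positivity), one_div_mul_cancel h0.ne', Real.rpow_one]
  have hqθ : θ ^ (1 / α) ≤ q := by
    refine Real.rpow_le_rpow hθ0.le ?_ (by linarith)
    rw [le_div_iff₀ hδ0]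
    nlinarith
  have hq4 : q ≤ 1 / 4 := by
    have h2 : θ / δ ≤ 1 / 4 := by rw [div_le_iff₀ hδ0]; linarith
    calc q ≤ (1 / 4) ^ (1 / α) := Real.rpow_le_rpow (by positivity) h2 (by linarith)
      _ ≤ (1 / 4) ^ (1 : ℝ) :=
        Real.rpow_le_rpow_of_exponent_ge (by norm_num) (by norm_num) hα1
      _ = 1 / 4 := Real.rpow_one _
  set M := 2 * n * q with hM
  have hMlow : 2 * (n * θ ^ (1 / α)) ≤ M := by
    rw [hM, mul_assoc]; gcongr
  have hM2 : 2 ≤ M := by linarith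
  have hMn : 2 * M ≤ n := by rw [hM]; nlinarith
  have hmem : ∀ m ∈ Finset.Icc ⌈M⌉₊ ⌊2 * M⌋₊, M ≤ m ∧ (m : ℝ) ≤ 2 * M := fun m hm => by
    rw [Finset.mem_Icc] at hm
    exact ⟨Nat.ceil_le.1 hm.1, (Nat.le_floor_iff (by linarith)).1 hm.2⟩
  have hT : ∀ m ∈ Finset.Icc ⌈M⌉₊ ⌊2 * M⌋₊, 2 ≤ m ∧ m ≤ n := fun m hm => by
    have h := hmem m hm
    constructor
    · have : (2 : ℝ) ≤ m := hM2.trans h.1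
      exact_mod_cast this
    · have : (m : ℝ) ≤ n := h.2.trans hMn
      exact_mod_cast this
  refine (cosProdMean_le_of_growth_le h0.le h1 hn1 hθ0 hT fun m hm => ?_).trans
    (Real.exp_le_exp.2 (neg_le_neg ?_))
  · have hm' := hT m hm
    have hm0 : (0 : ℝ) < m := by exact_mod_cast (by omega : 0 < m)
    have h2 := growth_le_two_mul_div_rpow h0.le hm'.1 hm'.2
    have h3 : (2 * (n : ℝ) / m) ^ α ≤ (1 / q) ^ α := by
      refine Real.rpow_le_rpow (by positivity) ?_ h0.le
      rw [div_le_div_iff₀ hm0 hq0, one_mul]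
      exact (hmem m hm).1
    rw [Real.div_rpow zero_le_one hq0.le, hqα, Real.one_rpow, one_div_div] at h3
    calc θ * growth α n m ≤ θ * (δ / θ) := by gcongr; exact h2.trans h3
      _ = δ := by field_simp
  · have e1 : ∀ m ∈ Finset.Icc ⌈M⌉₊ ⌊2 * M⌋₊, δ ^ 2 / 16 ≤ θ ^ 2 * growth α n m ^ 2 := by
      intro m hm
      have hm' := hT m hm
      have hm0 : (0 : ℝ) < m := by exact_mod_cast (by omega : 0 < m)
      have h2 := rpow_le_growth h0.le h1.le (by omega : 1 ≤ m) hm'.2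
      have h3 : (1 / 4 / q) ^ α ≤ ((n : ℝ) / m) ^ α := by
        refine Real.rpow_le_rpow (by positivity) ?_ h0.le
        rw [div_le_div_iff₀ hq0 hm0]
        have := (hmem m hm).2
        rw [hM] at this
        linarith
      rw [Real.div_rpow (by norm_num) hq0.le, hqα] at h3
      have h4 : (1 / 4 : ℝ) ≤ (1 / 4) ^ α := by
        calc (1 / 4 : ℝ) = (1 / 4) ^ (1 : ℝ) := (Real.rpow_one _).symm
          _ ≤ _ := Real.rpow_le_rpow_of_exponent_ge (by norm_num) (by norm_num) h1.le
      have h5 : 1 / 4 / (θ / δ) ≤ growth α n m := by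
        refine le_trans ?_ (h3.trans h2)
        gcongr
      have h6 : δ / 4 ≤ θ * growth α n m := by
        calc δ / 4 = θ * (1 / 4 / (θ / δ)) := by field_simp
          _ ≤ _ := by gcongr
      rw [← mul_pow]
      calc δ ^ 2 / 16 = (δ / 4) ^ 2 := by ring
        _ ≤ _ := by gcongr
    have e2 := Finset.sum_le_sum e1
    rw [Finset.sum_const, nsmul_eq_mul] at e2
    have hcard : n * θ ^ (1 / α) ≤ (Finset.Icc ⌈M⌉₊ ⌊2 * M⌋₊).card := by
      have h2 : (⌈M⌉₊ : ℝ) ≤ M + 1 := (Nat.ceil_lt_add_one (by linarith)).le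
      have h3 : 2 * M ≤ ⌊2 * M⌋₊ + 1 := (Nat.lt_floor_add_one _).le
      have h4 : ⌊2 * M⌋₊ + 1 ≤ (Finset.Icc ⌈M⌉₊ ⌊2 * M⌋₊).card + ⌈M⌉₊ := by
        rw [Nat.card_Icc]; omega
      have h5 : (⌊2 * M⌋₊ : ℝ) + 1 ≤ (Finset.Icc ⌈M⌉₊ ⌊2 * M⌋₊).card + ⌈M⌉₊ := by exact_mod_cast h4
      linarith
    calc (1 - α) ^ 2 / 40 * (δ ^ 2 / 16) * (n * θ ^ (1 / α))
        ≤ (1 - α) ^ 2 / 40 * (δ ^ 2 / 16) * (Finset.Icc ⌈M⌉₊ ⌊2 * M⌋₊).card := by gcongr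
      _ = (1 - α) ^ 2 / 40 * ((Finset.Icc ⌈M⌉₊ ⌊2 * M⌋₊).card * (δ ^ 2 / 16)) := by ring
      _ ≤ _ := by gcongr

/-! ### Frequencies of the cycle -/

/-- At `C` times the mixing scale and later, the characteristic function at the angle `π * j / L`
is exponentially small in `C * j`; the next two lemmas are the same in the other regimes. -/
lemma exists_cosProdMean_cycle_le_subcritical {α : ℝ} (h0 : 0 ≤ α) (h1 : α < 1) :
    ∃ a : ℝ, 0 < a ∧ ∃ L₀ : ℕ, ∀ L : ℕ, L₀ ≤ L → ∀ C : ℝ, 1 ≤ C → ∀ n : ℕ,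
      C * (L : ℝ) ^ 2 ≤ n → ∀ j : ℕ, 1 ≤ j → 2 * j ≤ L →
        cosProdMean α n (Real.pi * j / L) ≤ Real.exp (-(a * C * j)) := by
  obtain ⟨c, hc, h⟩ := exists_cosProdMean_le_sq h0 h1
  refine ⟨c, hc, 2, fun L hL C hC n hn j hj hjL => ?_⟩
  have hL2 : (2 : ℝ) ≤ L := by exact_mod_cast hL
  have hj1 : (1 : ℝ) ≤ j := by exact_mod_cast hj
  have hjL' : 2 * (j : ℝ) ≤ L := by exact_mod_cast hjL
  have hn2 : 2 ≤ n := by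
    have : (2 : ℝ) ≤ n := by nlinarith
    exact_mod_cast this
  have hπ := Real.pi_gt_three
  refine (h n hn2 _ (by positivity) ?_).trans (Real.exp_le_exp.2 (neg_le_neg ?_))
  · rw [div_le_div_iff₀ (by linarith) (by norm_num)]
    nlinarith
  · rw [mul_assoc]
    refine mul_le_mul_of_nonneg_left ?_ hc.le
    calc C * j ≤ C * (Real.pi * j) ^ 2 := by
          gcongr
          have h2 : (j : ℝ) ≤ Real.pi * j := by nlinarith
          nlinarith
      _ = C * L ^ 2 * (Real.pi * j / L) ^ 2 := by field_simp
      _ ≤ _ := by gcongr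

lemma exists_cosProdMean_cycle_le_critical :
    ∃ a : ℝ, 0 < a ∧ ∃ L₀ : ℕ, ∀ L : ℕ, L₀ ≤ L → ∀ C : ℝ, 1 ≤ C → ∀ n : ℕ,
      C * (L : ℝ) ^ 2 / Real.log L ≤ n → ∀ j : ℕ, 1 ≤ j → 2 * j ≤ L →
        cosProdMean (1 / 2) n (Real.pi * j / L) ≤ Real.exp (-(a * C * j)) := by
  obtain ⟨c₁, hc₁, h₁⟩ := exists_cosProdMean_le_sq (α := 1 / 2) (by norm_num) (by norm_num)
  obtain ⟨c₂, θ₀, hc₂, hθ₀, h₂⟩ := exists_cosProdMean_half_le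
  refine ⟨min c₁ c₂, lt_min hc₁ hc₂, max 256 ⌈(Real.pi / θ₀) ^ 2⌉₊,
    fun L hL C hC n hn j hj hjL => ?_⟩
  have hL256 : (256 : ℝ) ≤ L := by exact_mod_cast (le_max_left _ _).trans hL
  have hLθ : (Real.pi / θ₀) ^ 2 ≤ L :=
    (Nat.le_ceil _).trans (by exact_mod_cast (le_max_right _ _).trans hL)
  have hj1 : (1 : ℝ) ≤ j := by exact_mod_cast hj
  have hjL' : 2 * (j : ℝ) ≤ L := by exact_mod_cast hjL
  have hπ := Real.pi_gt_three
  have hπ4 := Real.pi_lt_four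
  have hlog0 : 0 < Real.log L := Real.log_pos (by linarith)
  set r := Real.sqrt L with hr
  have hr2 : r ^ 2 = L := Real.sq_sqrt (by linarith)
  have hr0 : 0 ≤ r := Real.sqrt_nonneg _
  have hr16 : 16 ≤ r := Real.le_sqrt_of_sq_le (by linarith)
  have hlogr : Real.log L = 2 * Real.log r := by rw [← hr2, Real.log_pow]; norm_num
  have hlogr' : Real.log L ≤ 2 * r := by
    have := Real.log_le_sub_one_of_pos (by linarith : 0 < r)
    linarith
  have hnL : C * (L : ℝ) ^ 2 ≤ n * Real.log L := (div_le_iff₀ hlog0).1 hn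
  have hn0 : (0 : ℝ) ≤ n := Nat.cast_nonneg n
  -- `log L ≤ 2 * √L` makes `L ^ 2 / log L` at least `L`.
  have hnL1 : (L : ℝ) ≤ n := by
    have h1 : (L : ℝ) ^ 2 ≤ n * (2 * r) := by
      refine le_trans ?_ (hnL.trans (by gcongr))
      nlinarith [sq_nonneg (L : ℝ)]
    have h2 : 2 * r ≤ L := by nlinarith
    have h3 : (L : ℝ) * L ≤ n * L := by nlinarith
    exact le_of_mul_le_mul_right h3 (by linarith)
  have hθ0 : 0 < Real.pi * j / L := by positivity
  have hsq : C * (Real.pi * j) ^ 2 ≤ n * (Real.pi * j / L) ^ 2 * Real.log L := by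
    calc C * (Real.pi * j) ^ 2 = C * L ^ 2 * (Real.pi * j / L) ^ 2 := by field_simp
      _ ≤ n * Real.log L * (Real.pi * j / L) ^ 2 := by gcongr
      _ = _ := by ring
  have hC0 : 0 ≤ C * j := by positivity
  rcases le_or_gt r j with hrj | hrj
  · -- High frequencies: `j ≥ √L` outweighs the missing logarithm.
    have hn2 : 2 ≤ n := by
      have : (2 : ℝ) ≤ n := by linarith
      exact_mod_cast this
    refine (h₁ n hn2 _ hθ0 ?_).trans (Real.exp_le_exp.2 (neg_le_neg ?_))
    · rw [div_le_div_iff₀ (by linarith) (by norm_num)]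
      nlinarith
    · have h3 : C * j ≤ n * (Real.pi * j / L) ^ 2 := by
        refine le_of_mul_le_mul_right (le_trans ?_ hsq) hlog0
        calc C * j * Real.log L ≤ C * j * (2 * r) := by gcongr
          _ ≤ C * j * (2 * j) := by gcongr
          _ ≤ C * j * (Real.pi ^ 2 * j) := by gcongr; nlinarith
          _ = C * (Real.pi * j) ^ 2 := by ring
      calc min c₁ c₂ * C * j = min c₁ c₂ * (C * j) := by ring
        _ ≤ c₁ * (n * (Real.pi * j / L) ^ 2) :=
          mul_le_mul (min_le_left _ _) h3 hC0 hc₁.le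
  · have hθr : Real.pi * j / L ≤ Real.pi / r := by
      rw [div_le_div_iff₀ (by linarith) (by linarith), ← hr2]
      nlinarith [mul_pos Real.pi_pos (by linarith : 0 < r)]
    have hθle : Real.pi * j / L ≤ θ₀ := by
      refine hθr.trans ?_
      rw [div_le_iff₀ (by linarith), mul_comm, ← div_le_iff₀ hθ₀]
      exact Real.le_sqrt_of_sq_le hLθ
    refine (h₂ n _ hθ0 hθle ?_).trans (Real.exp_le_exp.2 (neg_le_neg ?_))
    · calc (2 : ℝ) ≤ L * (Real.pi * j / L) := by
            have : (L : ℝ) * (Real.pi * j / L) = Real.pi * j := by field_simp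
            rw [this]; nlinarith
        _ ≤ _ := by gcongr
    · have h3 : Real.log L / 4 ≤ Real.log (1 / (Real.pi * j / L)) := by
        have h4 : Real.sqrt r ≤ 1 / (Real.pi * j / L) := by
          refine le_trans ?_ (one_div_le_one_div_of_le hθ0 hθr)
          rw [one_div_div]
          refine Real.sqrt_le_iff.2 ⟨by positivity, ?_⟩
          rw [div_pow, le_div_iff₀ (by positivity)]
          have hπ2 : Real.pi ^ 2 ≤ 16 := by nlinarith only [hπ, hπ4]
          nlinarith only [hπ2, hr16]
        refine le_trans (le_of_eq ?_) (Real.log_le_log (by positivity) h4)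
        rw [Real.log_sqrt hr0, hlogr]
        ring
      have h5 : C * j ≤ n * (Real.pi * j / L) ^ 2 * Real.log (1 / (Real.pi * j / L)) := by
        calc C * j ≤ C * (Real.pi * j) ^ 2 / 4 := by
              have h6 : 2 * (j : ℝ) ≤ Real.pi * j := by nlinarith only [hπ, hj1]
              have h7 : (j : ℝ) ≤ (Real.pi * j) ^ 2 / 4 := by nlinarith only [h6, hj1]
              rw [mul_div_assoc]
              gcongr
          _ ≤ n * (Real.pi * j / L) ^ 2 * Real.log L / 4 := by gcongr
          _ = n * (Real.pi * j / L) ^ 2 * (Real.log L / 4) := by ring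
          _ ≤ _ := by gcongr
      calc min c₁ c₂ * C * j = min c₁ c₂ * (C * j) := by ring
        _ ≤ _ := mul_le_mul (min_le_right _ _) h5 hC0 hc₂.le

lemma exists_cosProdMean_cycle_le_supercritical {α : ℝ} (h0 : 0 < α) (h1 : α < 1) :
    ∃ a : ℝ, 0 < a ∧ ∃ L₀ : ℕ, ∀ L : ℕ, L₀ ≤ L → ∀ C : ℝ, 1 ≤ C → ∀ n : ℕ,
      C * (L : ℝ) ^ (1 / α) ≤ n → ∀ j : ℕ, 1 ≤ j → 2 * j ≤ L →
        cosProdMean α n (Real.pi * j / L) ≤ Real.exp (-(a * C * j)) := by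
  obtain ⟨c₁, hc₁, h₁⟩ := exists_cosProdMean_le_sq h0.le h1
  obtain ⟨c₂, θ₀, hc₂, hθ₀, h₂⟩ := exists_cosProdMean_le_rpow h0 h1
  refine ⟨min (c₁ * θ₀ ^ 2) c₂, lt_min (by positivity) hc₂, 2, fun L hL C hC n hn j hj hjL => ?_⟩
  have hL2 : (2 : ℝ) ≤ L := by exact_mod_cast hL
  have hj1 : (1 : ℝ) ≤ j := by exact_mod_cast hj
  have hjL' : 2 * (j : ℝ) ≤ L := by exact_mod_cast hjL
  have hπ := Real.pi_gt_three
  have hα1 : 1 ≤ 1 / α := by rw [le_div_iff₀ h0]; linarith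
  have hθ0 : 0 < Real.pi * j / L := by positivity
  have hC0 : 0 ≤ C * j := by positivity
  have hnL : C * L ≤ n := by
    refine le_trans ?_ hn
    gcongr
    exact Real.self_le_rpow_of_one_le (by linarith) hα1
  rcases le_or_gt (Real.pi * j / L) θ₀ with h | h
  · have h3 : C * j ≤ n * (Real.pi * j / L) ^ (1 / α) := by
      calc C * j ≤ C * (Real.pi * j) ^ (1 / α) := by
            gcongr
            refine le_trans ?_ (Real.self_le_rpow_of_one_le (by nlinarith) hα1)
            nlinarith
        _ = C * L ^ (1 / α) * (Real.pi * j / L) ^ (1 / α) := by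
            rw [mul_assoc, ← Real.mul_rpow (by positivity) hθ0.le]
            congr 2
            field_simp
        _ ≤ _ := by gcongr
    refine (h₂ n _ hθ0 h ?_).trans (Real.exp_le_exp.2 (neg_le_neg ?_))
    · nlinarith
    · calc min (c₁ * θ₀ ^ 2) c₂ * C * j = min (c₁ * θ₀ ^ 2) c₂ * (C * j) := by ring
        _ ≤ _ := mul_le_mul (min_le_right _ _) h3 hC0 hc₂.le
  · have hn2 : 2 ≤ n := by
      have : (2 : ℝ) ≤ n := by nlinarith
      exact_mod_cast this
    refine (h₁ n hn2 _ hθ0 ?_).trans (Real.exp_le_exp.2 (neg_le_neg ?_))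
    · rw [div_le_div_iff₀ (by linarith) (by norm_num)]
      nlinarith
    · calc min (c₁ * θ₀ ^ 2) c₂ * C * j = min (c₁ * θ₀ ^ 2) c₂ * (C * j) := by ring
        _ ≤ (c₁ * θ₀ ^ 2) * (C * L) := by
          refine mul_le_mul (min_le_left _ _) ?_ hC0 (by positivity)
          gcongr
          linarith
        _ ≤ (c₁ * (Real.pi * j / L) ^ 2) * n := by gcongr
        _ = _ := by ring

/-! ### The walk on the cycle as a projection of a walk on the integers -/

/-- The integer lift of a step of the walk on the cycle: `1` for the step `1` and `-1` for the
only other step, `-1`. -/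
def stepSign {L : ℕ} (x : ZMod L) : ℤ := if x = 1 then 1 else -1

/-- The walk on `ℤ` that lifts the walk on the cycle with step sequence `X`. -/
def liftedWalk {Ω : Type*} {L : ℕ} (X : ℕ → Ω → ZMod L) (n : ℕ) (ω : Ω) : ℤ :=
  ∑ i ∈ Finset.range n, stepSign (X (i + 1) ω)

lemma stepSign_eq_or {L : ℕ} (x : ZMod L) : stepSign x = 1 ∨ stepSign x = -1 := by
  unfold stepSign
  split_ifs <;> simp

lemma abs_liftedWalk_le {Ω : Type*} {L : ℕ} (X : ℕ → Ω → ZMod L) (n : ℕ) (ω : Ω) :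
    |liftedWalk X n ω| ≤ n := by
  refine (Finset.abs_sum_le_sum_abs _ _).trans ?_
  refine (Finset.sum_le_card_nsmul _ _ 1 fun i _ => ?_).trans (by simp)
  rcases stepSign_eq_or (X (i + 1) ω) with h | h <;> simp [h]

lemma integrable_comp_of_abs_le {Ω : Type*} [MeasurableSpace Ω] {P : Measure Ω}
    [IsFiniteMeasure P] {Z : Ω → ℤ} (hZ : Measurable Z) {N : ℤ} (h : ∀ ω, |Z ω| ≤ N) (f : ℤ → ℂ) :
    Integrable (fun ω => f (Z ω)) P := by
  refine Integrable.of_bound (C := ∑ z ∈ Finset.Icc (-N) N, ‖f z‖)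
    ((measurable_of_countable f).comp hZ).aestronglyMeasurable
    (Filter.Eventually.of_forall fun ω => ?_)
  exact Finset.single_le_sum (f := fun z => ‖f z‖) (fun _ _ => norm_nonneg _)
    (Finset.mem_Icc.2 (abs_le.1 (h ω)))

instance isProbabilityMeasure_cycleStep (L : ℕ) : IsProbabilityMeasure (cycleStep L) := by
  constructor
  simp [cycleStep, ENNReal.inv_two_add_inv_two]

lemma neg_one_ne_one_zmod {L : ℕ} (hL : 3 ≤ L) : (-1 : ZMod L) ≠ 1 := by
  have : Fact (2 < L) := ⟨hL⟩
  exact ZMod.neg_one_ne_one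

lemma cycleStep_real_one {L : ℕ} (hL : 3 ≤ L) : (cycleStep L).real {1} = 1 / 2 := by
  simp [cycleStep, measureReal_def, neg_one_ne_one_zmod hL]

lemma cycleStep_compl {L : ℕ} : cycleStep L {1, -1}ᶜ = 0 := by
  simp [cycleStep]

section Driven

variable {Ω : Type*} [MeasurableSpace Ω] {L : ℕ} {P : Measure Ω}
  {α : unitInterval} {ξ : ℕ → Ω → Bool} {u : ℕ → Ω → ℕ} {Y X S : ℕ → Ω → ZMod L}

/-- The steps up to time `n` are functions of the data up to time `n`. -/
lemma IsSRRWDrivenBy.exists_step_eq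
    (h : IsSRRWDrivenBy P α (cycleStep L) ξ u Y X S) (n : ℕ) :
    ∃ F : ℕ → (Finset.Icc 1 n → Bool × ℕ × ZMod L) → ZMod L, ∀ k, 1 ≤ k → k ≤ n → ∀ ω,
      X k ω = F k (fun i => (ξ i ω, u i ω, Y i ω)) := by
  suffices H : ∀ k, 1 ≤ k → k ≤ n → ∃ F : (Finset.Icc 1 n → Bool × ℕ × ZMod L) → ZMod L,
      ∀ ω, X k ω = F (fun i => (ξ i ω, u i ω, Y i ω)) by
    choose! F hF using H
    exact ⟨F, hF⟩
  intro k
  induction k using Nat.strong_induction_on with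
  | _ k ih =>
    intro hk1 hkn
    choose! F hF using ih
    rcases hk1.eq_or_lt with rfl | hk2
    · exact ⟨fun d => (d ⟨1, Finset.mem_Icc.2 ⟨le_rfl, hkn⟩⟩).2.2, fun ω => h.step_one ω⟩
    · let i : Finset.Icc 1 n := ⟨k, Finset.mem_Icc.2 ⟨hk1, hkn⟩⟩
      refine ⟨fun d => if (d i).1 = true then F (d i).2.1 d else (d i).2.2, fun ω => ?_⟩
      have hu := h.time_mem k hk2 ω
      rw [h.step k hk2 ω, hF (u k ω) hu.2 hu.1 (hu.2.le.trans hkn) ω]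

lemma IsSRRWDrivenBy.measurable_data (h : IsSRRWDrivenBy P α (cycleStep L) ξ u Y X S) (n : ℕ) :
    Measurable (fun ω => (ξ n ω, u n ω, Y n ω)) :=
  (h.measurable_coin n).prodMk ((h.measurable_time n).prodMk (h.measurable_fresh n))

lemma IsSRRWDrivenBy.measurable_step [NeZero L] (h : IsSRRWDrivenBy P α (cycleStep L) ξ u Y X S)
    {n : ℕ} (hn : 1 ≤ n) : Measurable (X n) := by
  obtain ⟨F, hF⟩ := h.exists_step_eq n
  rw [funext (hF n hn le_rfl)]
  exact (measurable_of_countable (F n)).comp (measurable_pi_lambda _ fun i => h.measurable_data i)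

lemma IsSRRWDrivenBy.measurable_liftedWalk [NeZero L]
    (h : IsSRRWDrivenBy P α (cycleStep L) ξ u Y X S) (n : ℕ) : Measurable (liftedWalk X n) := by
  refine Finset.measurable_sum _ fun i _ => ?_
  exact (measurable_of_countable stepSign).comp (h.measurable_step (by omega))

/-- Functions of the data up to time `n` are independent of the data at time `n + 1`. -/
lemma IsSRRWDrivenBy.integral_indicator_mul [NeZero L]
    (h : IsSRRWDrivenBy P α (cycleStep L) ξ u Y X S) (n : ℕ)
    (B : Set (Bool × ℕ × ZMod L)) (Φ : (Finset.Icc 1 n → Bool × ℕ × ZMod L) → ℂ) :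
    ∫ ω, B.indicator 1 (ξ (n + 1) ω, u (n + 1) ω, Y (n + 1) ω) *
        Φ (fun i => (ξ i ω, u i ω, Y i ω)) ∂P =
      (P.map (fun ω => (ξ (n + 1) ω, u (n + 1) ω, Y (n + 1) ω))).real B *
        ∫ ω, Φ (fun i => (ξ i ω, u i ω, Y i ω)) ∂P := by
  have hH : Measurable fun ω (i : Finset.Icc 1 n) => (ξ i ω, u i ω, Y i ω) :=
    measurable_pi_lambda _ fun i => h.measurable_data i
  have hind : IndepFun (fun ω => (ξ (n + 1) ω, u (n + 1) ω, Y (n + 1) ω))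
      (fun ω (i : Finset.Icc 1 n) => (ξ i ω, u i ω, Y i ω)) P := by
    have h1 := h.indep.indepFun_finset {n + 1} (Finset.Icc 1 n) (by simp) h.measurable_data
    exact h1.comp (φ := fun d => d ⟨n + 1, Finset.mem_singleton_self _⟩) (ψ := id)
      (measurable_of_countable _) measurable_id
  rw [hind.integral_fun_comp_mul_comp (f := B.indicator 1) (g := Φ)
    (h.measurable_data _).aemeasurable hH.aemeasurable
    (measurable_of_countable _).aestronglyMeasurable
    (measurable_of_countable _).aestronglyMeasurable]
  congr 1
  have hB : MeasurableSet B := B.to_countable.measurableSet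
  have e : (fun ω => B.indicator (1 : Bool × ℕ × ZMod L → ℂ)
      (ξ (n + 1) ω, u (n + 1) ω, Y (n + 1) ω)) =
      fun ω => (((fun ω => (ξ (n + 1) ω, u (n + 1) ω, Y (n + 1) ω)) ⁻¹' B).indicator 1 ω : ℂ) := by
    funext ω
    simp only [Set.indicator, Pi.one_apply]
    rfl
  rw [e, map_measureReal_apply (h.measurable_data _) hB]
  rw [integral_indicator (h.measurable_data _ hB)]
  simp

lemma IsSRRWDrivenBy.integral_step_true [NeZero L]
    (h : IsSRRWDrivenBy P α (cycleStep L) ξ u Y X S) {n k : ℕ} (hk : k ∈ Finset.Icc 1 n)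
    (Φ : (Finset.Icc 1 n → Bool × ℕ × ZMod L) → ℂ) :
    ∫ ω, ({true} ×ˢ {k} ×ˢ Set.univ : Set (Bool × ℕ × ZMod L)).indicator 1
        (ξ (n + 1) ω, u (n + 1) ω, Y (n + 1) ω) * Φ (fun i => (ξ i ω, u i ω, Y i ω)) ∂P =
      ((α : ℝ) / n : ℝ) * ∫ ω, Φ (fun i => (ξ i ω, u i ω, Y i ω)) ∂P := by
  have hk' := Finset.mem_Icc.1 hk
  rw [h.integral_indicator_mul, h.law_triple (n + 1) (by omega), measureReal_prod_prod,
    measureReal_prod_prod]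
  have e1 : (bernoulliMeasure true false α).real {true} = α := by
    rw [bernoulliMeasure_real_apply _ (by measurability)]
    simp
  have e2 : (uniformOn (Set.Ico 1 (n + 1))).real {k} = 1 / n := by
    have e3 : (Set.Ico 1 (n + 1)) = ((Finset.Icc 1 n : Finset ℕ) : Set ℕ) := by
      ext; simp
    rw [e3, ← Finset.coe_singleton, measureReal_def, uniformOn_apply_finset,
      Finset.inter_singleton_of_mem hk]
    simp
  rw [e1, e2]
  simp [div_eq_mul_inv]

lemma IsSRRWDrivenBy.integral_step_false [NeZero L]
    (h : IsSRRWDrivenBy P α (cycleStep L) ξ u Y X S) {n : ℕ} (hn : 1 ≤ n) {A : Set (ZMod L)}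
    (hA : (cycleStep L).real A = 1 / 2) (Φ : (Finset.Icc 1 n → Bool × ℕ × ZMod L) → ℂ) :
    ∫ ω, ({false} ×ˢ Set.univ ×ˢ A : Set (Bool × ℕ × ZMod L)).indicator 1
        (ξ (n + 1) ω, u (n + 1) ω, Y (n + 1) ω) * Φ (fun i => (ξ i ω, u i ω, Y i ω)) ∂P =
      ((1 - (α : ℝ)) / 2 : ℝ) * ∫ ω, Φ (fun i => (ξ i ω, u i ω, Y i ω)) ∂P := by
  have : IsProbabilityMeasure (uniformOn (Set.Ico 1 (n + 1))) :=
    isProbabilityMeasure_uniformOn (Set.finite_Ico _ _) ⟨1, by simp; omega⟩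
  rw [h.integral_indicator_mul, h.law_triple (n + 1) (by omega), measureReal_prod_prod,
    measureReal_prod_prod, hA]
  have e1 : (bernoulliMeasure true false α).real {false} = 1 - α := by
    rw [bernoulliMeasure_real_apply _ (by measurability)]
    simp
  rw [e1]
  simp [div_eq_mul_inv]

/-- The lifted walk is a Markov chain with transitions `walkStep`: the future only depends on the
numbers of past steps of either sign, and these are determined by the present position. -/
lemma IsSRRWDrivenBy.integral_liftedWalk_succ [IsProbabilityMeasure P] (hL : 3 ≤ L)
    (h : IsSRRWDrivenBy P α (cycleStep L) ξ u Y X S) (n : ℕ) (f : ℤ → ℂ) :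
    ∫ ω, f (liftedWalk X (n + 1) ω) ∂P = ∫ ω, walkStep (α : ℝ) n f (liftedWalk X n ω) ∂P := by
  have : NeZero L := ⟨by omega⟩
  have hplus := cycleStep_real_one hL
  have hminus : (cycleStep L).real {1}ᶜ = 1 / 2 := by
    rw [probReal_compl_eq_one_sub (measurableSet_singleton _), hplus]
    norm_num
  rcases Nat.eq_zero_or_pos n with rfl | hn
  · have e1 : ∀ ω, liftedWalk X (0 + 1) ω = stepSign (Y 1 ω) := fun ω => by
      simp [liftedWalk, h.step_one]
    have e2 : ∫ ω, f (stepSign (Y 1 ω)) ∂P = ∫ y, f (stepSign y) ∂(cycleStep L) := by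
      rw [← h.law_first, integral_map (h.measurable_fresh 1).aemeasurable
        (measurable_of_countable _).aestronglyMeasurable]
    simp only [e1, e2]
    rw [cycleStep, integral_add_measure, integral_smul_measure, integral_smul_measure,
      integral_dirac, integral_dirac]
    · simp [liftedWalk, walkStep, stepSign, neg_one_ne_one_zmod hL]
    · exact (integrable_dirac (by simp)).smul_measure (by simp)
    · exact (integrable_dirac (by simp)).smul_measure (by simp)
  obtain ⟨F, hF⟩ := h.exists_step_eq n
  set W : (Finset.Icc 1 n → Bool × ℕ × ZMod L) → ℤ := fun d =>
    ∑ i ∈ Finset.range n, stepSign (F (i + 1) d) with hW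
  have hWeq : ∀ ω, liftedWalk X n ω = W (fun i => (ξ i ω, u i ω, Y i ω)) := fun ω => by
    refine Finset.sum_congr rfl fun i hi => ?_
    rw [hF (i + 1) (by omega) (by simpa using hi)]
  have hsplit : ∀ ω, f (liftedWalk X (n + 1) ω) =
      (∑ k ∈ Finset.Icc 1 n, ({true} ×ˢ {k} ×ˢ Set.univ : Set (Bool × ℕ × ZMod L)).indicator 1
        (ξ (n + 1) ω, u (n + 1) ω, Y (n + 1) ω) *
          f (liftedWalk X n ω + stepSign (X k ω))) +
      (({false} ×ˢ Set.univ ×ˢ {1} : Set (Bool × ℕ × ZMod L)).indicator 1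
        (ξ (n + 1) ω, u (n + 1) ω, Y (n + 1) ω) * f (liftedWalk X n ω + 1) +
      ({false} ×ˢ Set.univ ×ˢ {1}ᶜ : Set (Bool × ℕ × ZMod L)).indicator 1
        (ξ (n + 1) ω, u (n + 1) ω, Y (n + 1) ω) * f (liftedWalk X n ω - 1)) := by
    intro ω
    have hlast : liftedWalk X (n + 1) ω = liftedWalk X n ω + stepSign (X (n + 1) ω) :=
      Finset.sum_range_succ _ _
    rw [hlast, h.step (n + 1) (by omega) ω]
    have hu := h.time_mem (n + 1) (by omega) ω
    rcases hξ : ξ (n + 1) ω with _ | _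
    · by_cases hY : Y (n + 1) ω = 1
      · simp [hY, stepSign, Set.indicator]
      · simp [hY, stepSign, Set.indicator, sub_eq_add_neg]
    · rw [Finset.sum_eq_single (u (n + 1) ω)]
      · simp [Set.indicator]
      · intro k _ hk
        simp [Set.indicator, hk.symm]
      · intro hk
        exact absurd (Finset.mem_Icc.2 ⟨hu.1, Nat.lt_succ_iff.1 hu.2⟩) hk
  have hind : ∀ (B : Set (Bool × ℕ × ZMod L)) (Z : Ω → ℤ), Measurable Z →
      (∀ ω, |Z ω| ≤ (n + 1 : ℤ)) →
      Integrable (fun ω => B.indicator 1 (ξ (n + 1) ω, u (n + 1) ω, Y (n + 1) ω) * f (Z ω)) P := by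
    intro B Z hZ hZn
    refine (integrable_comp_of_abs_le hZ hZn f).bdd_mul (c := 1)
      ((measurable_of_countable (B.indicator (1 : Bool × ℕ × ZMod L → ℂ))).comp
        (h.measurable_data (n + 1))).aestronglyMeasurable
      (Filter.Eventually.of_forall fun ω => ?_)
    by_cases hB : (ξ (n + 1) ω, u (n + 1) ω, Y (n + 1) ω) ∈ B <;> simp [hB]
  have hm := h.measurable_liftedWalk n
  have hbd := abs_liftedWalk_le X n
  have hm1 : ∀ k ∈ Finset.Icc 1 n, Measurable fun ω => liftedWalk X n ω + stepSign (X k ω) :=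
    fun k hk => hm.add
      ((measurable_of_countable stepSign).comp (h.measurable_step (Finset.mem_Icc.1 hk).1))
  have hb1 : ∀ k ω, |liftedWalk X n ω + stepSign (X k ω)| ≤ (n + 1 : ℤ) := fun k ω => by
    have := abs_le.1 (hbd ω)
    rcases stepSign_eq_or (X k ω) with hs | hs <;> rw [hs, abs_le] <;> constructor <;> omega
  have hb2 : ∀ ω, |liftedWalk X n ω + 1| ≤ (n + 1 : ℤ) := fun ω => by
    have := abs_le.1 (hbd ω)
    rw [abs_le]; constructor <;> omega
  have hb3 : ∀ ω, |liftedWalk X n ω - 1| ≤ (n + 1 : ℤ) := fun ω => by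
    have := abs_le.1 (hbd ω)
    rw [abs_le]; constructor <;> omega
  have hadd : Integrable (fun ω =>
      ({false} ×ˢ Set.univ ×ˢ {1} : Set (Bool × ℕ × ZMod L)).indicator 1
        (ξ (n + 1) ω, u (n + 1) ω, Y (n + 1) ω) * f (liftedWalk X n ω + 1) +
      ({false} ×ˢ Set.univ ×ˢ {1}ᶜ : Set (Bool × ℕ × ZMod L)).indicator 1
        (ξ (n + 1) ω, u (n + 1) ω, Y (n + 1) ω) * f (liftedWalk X n ω - 1)) P :=
    (hind _ _ (hm.add_const 1) hb2).add (hind _ _ (hm.sub_const 1) hb3)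
  simp only [hsplit]
  rw [integral_add (integrable_finsetSum _ fun k hk => hind _ _ (hm1 k hk) (hb1 k)) hadd,
    integral_finsetSum _ fun k hk => hind _ _ (hm1 k hk) (hb1 k),
    integral_add (hind _ _ (hm.add_const 1) hb2) (hind _ _ (hm.sub_const 1) hb3)]
  have e1 : ∀ k ∈ Finset.Icc 1 n,
      ∫ ω, ({true} ×ˢ {k} ×ˢ Set.univ : Set (Bool × ℕ × ZMod L)).indicator 1
        (ξ (n + 1) ω, u (n + 1) ω, Y (n + 1) ω) * f (liftedWalk X n ω + stepSign (X k ω)) ∂P =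
      ∫ ω, ((α : ℝ) / n : ℝ) * f (liftedWalk X n ω + stepSign (X k ω)) ∂P := by
    intro k hk
    have hk' := Finset.mem_Icc.1 hk
    rw [integral_const_mul]
    simp only [hWeq, hF k hk'.1 hk'.2]
    exact h.integral_step_true hk (fun d => f (W d + stepSign (F k d)))
  have e2 : ∫ ω, ({false} ×ˢ Set.univ ×ˢ {1} : Set (Bool × ℕ × ZMod L)).indicator 1
        (ξ (n + 1) ω, u (n + 1) ω, Y (n + 1) ω) * f (liftedWalk X n ω + 1) ∂P =
      ∫ ω, ((1 - (α : ℝ)) / 2 : ℝ) * f (liftedWalk X n ω + 1) ∂P := by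
    rw [integral_const_mul]
    simp only [hWeq]
    exact h.integral_step_false hn hplus (fun d => f (W d + 1))
  have e3 : ∫ ω, ({false} ×ˢ Set.univ ×ˢ {1}ᶜ : Set (Bool × ℕ × ZMod L)).indicator 1
        (ξ (n + 1) ω, u (n + 1) ω, Y (n + 1) ω) * f (liftedWalk X n ω - 1) ∂P =
      ∫ ω, ((1 - (α : ℝ)) / 2 : ℝ) * f (liftedWalk X n ω - 1) ∂P := by
    rw [integral_const_mul]
    simp only [hWeq]
    exact h.integral_step_false hn hminus (fun d => f (W d - 1))
  have i1 : ∀ k ∈ Finset.Icc 1 n, Integrable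
      (fun ω => (((α : ℝ) / n : ℝ) : ℂ) * f (liftedWalk X n ω + stepSign (X k ω))) P :=
    fun k hk => (integrable_comp_of_abs_le (hm1 k hk) (hb1 k) f).const_mul _
  have i2 := (integrable_comp_of_abs_le (P := P) (hm.add_const 1) hb2 f).const_mul
    ((((1 - (α : ℝ)) / 2 : ℝ) : ℂ))
  have i3 := (integrable_comp_of_abs_le (P := P) (hm.sub_const 1) hb3 f).const_mul
    ((((1 - (α : ℝ)) / 2 : ℝ) : ℂ))
  have i4 : Integrable (fun ω => ((1 - (α : ℝ)) / 2 : ℝ) * f (liftedWalk X n ω + 1) +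
      ((1 - (α : ℝ)) / 2 : ℝ) * f (liftedWalk X n ω - 1)) P := i2.add i3
  rw [Finset.sum_congr rfl e1, e2, e3, ← integral_finsetSum _ i1, ← integral_add i2 i3,
    ← integral_add (integrable_finsetSum _ i1) i4]
  refine integral_congr_ae (Filter.Eventually.of_forall fun ω => ?_)
  have e4 : ∀ k, f (liftedWalk X n ω + stepSign (X k ω)) =
      (1 + (stepSign (X k ω) : ℂ)) / 2 * f (liftedWalk X n ω + 1) +
        (1 - (stepSign (X k ω) : ℂ)) / 2 * f (liftedWalk X n ω - 1) := fun k => by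
    rcases stepSign_eq_or (X k ω) with hs | hs <;> simp [hs, sub_eq_add_neg]
  have e5 : ∑ k ∈ Finset.Icc 1 n, (stepSign (X k ω) : ℂ) = (liftedWalk X n ω : ℂ) := by
    rw [liftedWalk, Int.cast_sum, Finset.range_eq_Ico, Finset.sum_Ico_add' (fun k =>
      ((stepSign (X k ω) : ℤ) : ℂ)) 0 n 1]
    refine Finset.sum_congr ?_ fun _ _ => rfl
    ext; simp
  simp only [e4]
  rw [← Finset.mul_sum, Finset.sum_add_distrib, ← Finset.sum_mul, ← Finset.sum_mul,
    ← Finset.sum_div, ← Finset.sum_div, Finset.sum_add_distrib, Finset.sum_sub_distrib, e5]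
  have hn0 : (n : ℂ) ≠ 0 := by exact_mod_cast (by omega : n ≠ 0)
  simp only [walkStep, Complex.real_smul, Finset.sum_const, Nat.card_Icc, nsmul_eq_mul]
  push_cast
  field_simp
  ring

lemma IsSRRWDrivenBy.integral_liftedWalk [IsProbabilityMeasure P] (hL : 3 ≤ L)
    (h : IsSRRWDrivenBy P α (cycleStep L) ξ u Y X S) (n : ℕ) :
    ∀ f : ℤ → ℂ, ∫ ω, f (liftedWalk X n ω) ∂P = walkMean (α : ℝ) n f := by
  induction n with
  | zero => intro f; simp [liftedWalk, walkMean]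
  | succ n ih =>
    intro f
    rw [h.integral_liftedWalk_succ hL, ih, walkMean]

lemma IsSRRWDrivenBy.ae_fresh_mem [IsProbabilityMeasure P]
    (h : IsSRRWDrivenBy P α (cycleStep L) ξ u Y X S) {n : ℕ} (hn : 1 ≤ n) :
    ∀ᵐ ω ∂P, Y n ω ∈ ({1, -1} : Set (ZMod L)) := by
  have hlaw : P.map (Y n) = cycleStep L := by
    rcases hn.eq_or_lt with rfl | hn2
    · exact h.law_first
    · have : IsProbabilityMeasure (uniformOn (Set.Ico 1 n)) :=
        isProbabilityMeasure_uniformOn (Set.finite_Ico _ _) ⟨1, by simp; omega⟩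
      have e : (P.map (fun ω => (ξ n ω, u n ω, Y n ω))).map (Prod.snd ∘ Prod.snd) =
          ((bernoulliMeasure true false α).prod
            ((uniformOn (Set.Ico 1 n)).prod (cycleStep L))).map (Prod.snd ∘ Prod.snd) := by
        rw [h.law_triple n hn2]
      rw [Measure.map_map (measurable_snd.comp measurable_snd) (h.measurable_data n),
        ← Measure.map_map measurable_snd measurable_snd, ← Measure.snd, ← Measure.snd,
        Measure.snd_prod, Measure.snd_prod] at e
      exact e
  have h2 : ∀ᵐ y ∂(P.map (Y n)), y ∈ ({1, -1} : Set (ZMod L)) := by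
    rw [hlaw, ae_iff]
    exact cycleStep_compl
  exact ae_of_ae_map (h.measurable_fresh n).aemeasurable h2

/-- The walk on the cycle is the projection of the lifted walk. -/
lemma IsSRRWDrivenBy.ae_eq_liftedWalk [IsProbabilityMeasure P] (hL : 3 ≤ L)
    (h : IsSRRWDrivenBy P α (cycleStep L) ξ u Y X S) (n : ℕ) :
    ∀ᵐ ω ∂P, S n ω = (liftedWalk X n ω : ZMod L) := by
  have hY : ∀ᵐ ω ∂P, ∀ n, 1 ≤ n → Y n ω ∈ ({1, -1} : Set (ZMod L)) :=
    ae_all_iff.2 fun n => Filter.eventually_imp_distrib_left.2 fun hn => h.ae_fresh_mem hn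
  filter_upwards [hY] with ω hω
  have hX : ∀ k, 1 ≤ k → X k ω ∈ ({1, -1} : Set (ZMod L)) := by
    intro k
    induction k using Nat.strong_induction_on with
    | _ k ih =>
      intro hk
      rcases hk.eq_or_lt with rfl | hk2
      · rw [h.step_one]; exact hω 1 le_rfl
      · have hu := h.time_mem k hk2 ω
        rw [h.step k hk2]
        split_ifs
        · exact ih _ hu.2 hu.1
        · exact hω k hk
  have hsign : ∀ k, 1 ≤ k → ((stepSign (X k ω) : ℤ) : ZMod L) = X k ω := by
    intro k hk
    rcases hX k hk with h1 | h1
    · simp [h1, stepSign]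
    · rw [Set.mem_singleton_iff] at h1
      simp [h1, stepSign, neg_one_ne_one_zmod hL]
  induction n with
  | zero => simp [h.walk_zero, liftedWalk]
  | succ n ih =>
    rw [h.walk_succ, ih, ← hsign (n + 1) (by omega)]
    simp [liftedWalk, Finset.sum_range_succ]

end Driven

/-! ### Total variation distance to the uniform distribution -/

lemma uniformOn_univ_real_coe {L : ℕ} [NeZero L] (s : Finset (ZMod L)) :
    (uniformOn (Set.univ : Set (ZMod L))).real s = s.card / L := by
  rw [measureReal_def, ← Finset.coe_univ, uniformOn_apply_finset, Finset.univ_inter,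
    Finset.card_univ, ZMod.card]
  simp

/-- Fourier inversion on `ZMod L`. For odd `L` the frequencies are indexed by `j * (L + 1) / 2`
instead of `j`, so that the character is `exp (π * i * j * (L + 1) * s / L)`. -/
lemma ite_eq_sum_stdAddChar {L : ℕ} [NeZero L] (hL : Odd L) (x : ZMod L) (s : ℤ) :
    (if (s : ZMod L) = x then 1 else 0 : ℂ) = (1 / L : ℂ) * ∑ j ∈ Finset.range L,
      ZMod.stdAddChar (-((j * ((L + 1) / 2 : ℕ) : ZMod L) * x)) *
        ZMod.stdAddChar ((j * ((L + 1) / 2 : ℕ) : ZMod L) * (s : ZMod L)) := by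
  set t : ZMod L := (((L + 1) / 2 : ℕ) : ZMod L) with ht
  have ht2 : 2 * t = 1 := by
    have h2 : 2 * ((L + 1) / 2) = L + 1 := by
      obtain ⟨k, rfl⟩ := hL
      omega
    have h3 := congrArg (fun k : ℕ => (k : ZMod L)) h2
    simpa [ht] using h3
  have e1 : ∑ j ∈ Finset.range L, ZMod.stdAddChar (-((j * t : ZMod L) * x)) *
        ZMod.stdAddChar ((j * t : ZMod L) * (s : ZMod L)) =
      ∑ y : ZMod L, ZMod.stdAddChar (y * (t * ((s : ZMod L) - x))) := by
    refine Finset.sum_nbij' (fun j : ℕ => (j : ZMod L)) ZMod.val (by simp)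
      (fun y _ => Finset.mem_range.2 (ZMod.val_lt y))
      (fun j hj => ZMod.val_cast_of_lt (Finset.mem_range.1 hj))
      (fun y _ => ZMod.natCast_zmod_val y) fun j _ => ?_
    rw [← AddChar.map_add_eq_mul]
    congr 1
    ring
  have hL0 : (L : ℂ) ≠ 0 := by exact_mod_cast NeZero.ne L
  have e2 : t * ((s : ZMod L) - x) = 0 ↔ (s : ZMod L) = x := by
    constructor
    · intro h
      have : (s : ZMod L) - x = 2 * (t * ((s : ZMod L) - x)) := by rw [← mul_assoc, ht2, one_mul]
      rw [h, mul_zero] at this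
      exact sub_eq_zero.1 this
    · rintro rfl
      simp
  rw [e1, AddChar.sum_mulShift _ (ZMod.isPrimitive_stdAddChar L), ZMod.card]
  simp only [e2]
  split_ifs <;> simp [hL0]

lemma stdAddChar_eq_exp {L : ℕ} [NeZero L] (hL : Odd L) (j : ℕ) (s : ℤ) :
    ZMod.stdAddChar ((j * ((L + 1) / 2 : ℕ) : ZMod L) * (s : ZMod L)) =
      Complex.exp (((Real.pi * j / L + j * Real.pi) * s : ℝ) * Complex.I) := by
  have h2 : 2 * ((L + 1) / 2) = L + 1 := by
    obtain ⟨k, rfl⟩ := hL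
    omega
  generalize (L + 1) / 2 = t at h2 ⊢
  have h3 : 2 * (t : ℂ) = L + 1 := by exact_mod_cast h2
  have hL0 : (L : ℂ) ≠ 0 := by exact_mod_cast NeZero.ne L
  have e : ((j * t : ZMod L) * (s : ZMod L)) = ((j * t * s : ℤ) : ZMod L) := by push_cast; rfl
  rw [e, ZMod.stdAddChar_coe]
  congr 1
  push_cast
  have e2 : 2 * (Real.pi : ℂ) * Complex.I * (j * t * s) / L =
      (2 * (t : ℂ)) * (Real.pi * Complex.I * j * s / L) := by ring
  rw [e2, h3]
  field_simp
  ring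

lemma cosProdMean_add_nat_mul_pi {α : ℝ} (h0 : 0 ≤ α) (h1 : α ≤ 1) (n : ℕ) (θ : ℝ) (j : ℕ) :
    cosProdMean α n (θ + j * Real.pi) = cosProdMean α n θ := by
  refine cosProdMean_congr h0 h1 n fun k => ?_
  have e : (k : ℝ) * (θ + j * Real.pi) = k * θ + (k * j : ℕ) * Real.pi := by push_cast; ring
  rw [e, Real.cos_add_nat_mul_pi, abs_mul, abs_pow]
  simp

lemma cosProdMean_pi_sub {α : ℝ} (h0 : 0 ≤ α) (h1 : α ≤ 1) (n : ℕ) (θ : ℝ) :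
    cosProdMean α n (Real.pi - θ) = cosProdMean α n θ := by
  refine cosProdMean_congr h0 h1 n fun k => ?_
  have e : (k : ℝ) * (Real.pi - θ) = k * Real.pi - k * θ := by ring
  rw [e, Real.cos_nat_mul_pi_sub, abs_mul, abs_pow]
  simp

lemma sum_cosProdMean_le {α : ℝ} (h0 : 0 ≤ α) (h1 : α ≤ 1) {n L : ℕ}
    {b : ℝ} (hb : Real.exp (-b) ≤ 1 / 2)
    (h : ∀ j : ℕ, 1 ≤ j → 2 * j ≤ L → cosProdMean α n (Real.pi * j / L) ≤ Real.exp (-(b * j))) :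
    ∑ j ∈ Finset.Ico 1 L, cosProdMean α n (Real.pi * j / L) ≤ 4 * Real.exp (-b) := by
  set q := Real.exp (-b) with hq
  have hq0 : 0 < q := Real.exp_pos _
  have hqj : ∀ j : ℕ, Real.exp (-(b * j)) = q ^ j := fun j => by
    rw [hq, ← Real.exp_nat_mul]; congr 1; ring
  have hterm : ∀ j ∈ Finset.Ico 1 L, cosProdMean α n (Real.pi * j / L) ≤ q ^ j + q ^ (L - j) := by
    intro j hj
    rw [Finset.mem_Ico] at hj
    have p1 : 0 ≤ q ^ j := by positivity
    have p2 : 0 ≤ q ^ (L - j) := by positivity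
    rcases le_or_gt (2 * j) L with hj2 | hj2
    · have := h j hj.1 hj2
      rw [hqj] at this
      linarith
    · have := h (L - j) (by omega) (by omega)
      have hL0 : (L : ℝ) ≠ 0 := by exact_mod_cast (by omega : L ≠ 0)
      have e : Real.pi * ((L - j : ℕ) : ℝ) / L = Real.pi - Real.pi * j / L := by
        rw [Nat.cast_sub hj.2.le]; field_simp
      rw [e, cosProdMean_pi_sub h0 h1, hqj] at this
      linarith
  have hgeom : ∑ j ∈ Finset.Ico 1 L, q ^ j ≤ 2 * q := by
    refine (geom_sum_Ico_le_of_lt_one hq0.le (by linarith)).trans ?_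
    rw [pow_one, div_le_iff₀ (by linarith)]
    nlinarith
  have hrefl : ∑ j ∈ Finset.Ico 1 L, q ^ (L - j) = ∑ j ∈ Finset.Ico 1 L, q ^ j := by
    refine Finset.sum_nbij' (fun j => L - j) (fun j => L - j) ?_ ?_ ?_ ?_ ?_ <;>
      simp only [Finset.mem_Ico] <;> intros <;> first | omega | trivial
  calc _ ≤ ∑ j ∈ Finset.Ico 1 L, (q ^ j + q ^ (L - j)) := Finset.sum_le_sum hterm
    _ = ∑ j ∈ Finset.Ico 1 L, q ^ j + ∑ j ∈ Finset.Ico 1 L, q ^ j := by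
      rw [Finset.sum_add_distrib, hrefl]
    _ ≤ 4 * q := by linarith

section Driven

variable {Ω : Type*} [MeasurableSpace Ω] {L : ℕ} {P : Measure Ω}
  {α : unitInterval} {ξ : ℕ → Ω → Bool} {u : ℕ → Ω → ℕ} {Y X S : ℕ → Ω → ZMod L}

lemma IsSRRWDrivenBy.map_real_apply [IsProbabilityMeasure P] (hL : 3 ≤ L)
    (h : IsSRRWDrivenBy P α (cycleStep L) ξ u Y X S) (n : ℕ) (A : Set (ZMod L)) :
    (P.map (S n)).real A = P.real {ω | (liftedWalk X n ω : ZMod L) ∈ A} := by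
  have : NeZero L := ⟨by omega⟩
  have e : P.map (S n) = P.map ((fun z : ℤ => (z : ZMod L)) ∘ liftedWalk X n) :=
    Measure.map_congr (h.ae_eq_liftedWalk hL n)
  rw [e, map_measureReal_apply
    ((measurable_of_countable (fun z : ℤ => (z : ZMod L))).comp (h.measurable_liftedWalk n))
    (Set.toFinite A).measurableSet]
  rfl

/-- The upper bound lemma: the total variation distance is at most the sum of the absolute values
of the Fourier coefficients at nonzero frequencies. -/
lemma IsSRRWDrivenBy.tvDist_le_sum [IsProbabilityMeasure P] (hL : 3 ≤ L) (hodd : Odd L)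
    (h : IsSRRWDrivenBy P α (cycleStep L) ξ u Y X S) (n : ℕ) :
    tvDist (P.map (S n)) (uniformOn Set.univ) ≤
      ∑ j ∈ Finset.Ico 1 L, cosProdMean α n (Real.pi * j / L) := by
  classical
  have : NeZero L := ⟨by omega⟩
  have hL0 : (0 : ℝ) < L := by exact_mod_cast (by omega : 0 < L)
  set D := ∑ j ∈ Finset.Ico 1 L, cosProdMean α n (Real.pi * j / L) with hD
  have hmeas := h.measurable_liftedWalk n
  have hφ : ∀ j : ℕ, ‖∫ ω, ZMod.stdAddChar ((j * ((L + 1) / 2 : ℕ) : ZMod L) *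
      (liftedWalk X n ω : ZMod L)) ∂P‖ ≤ cosProdMean α n (Real.pi * j / L) := by
    intro j
    simp only [stdAddChar_eq_exp hodd]
    rw [h.integral_liftedWalk hL n (fun s =>
      Complex.exp (((Real.pi * j / L + j * Real.pi) * s : ℝ) * Complex.I))]
    refine (norm_walkMean_exp_le α.2.1 α.2.2 n _).trans (le_of_eq ?_)
    exact cosProdMean_add_nat_mul_pi α.2.1 α.2.2 n _ j
  have hpoint : ∀ x : ZMod L, |P.real {ω | (liftedWalk X n ω : ZMod L) = x} - 1 / L| ≤ D / L := by
    intro x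
    have e1 : (P.real {ω | (liftedWalk X n ω : ZMod L) = x} : ℂ) =
        (1 / L : ℂ) * ∑ j ∈ Finset.range L,
          ZMod.stdAddChar (-((j * ((L + 1) / 2 : ℕ) : ZMod L) * x)) *
            ∫ ω, ZMod.stdAddChar ((j * ((L + 1) / 2 : ℕ) : ZMod L) *
              (liftedWalk X n ω : ZMod L)) ∂P := by
      have hset : MeasurableSet {ω | (liftedWalk X n ω : ZMod L) = x} :=
        hmeas (Set.to_countable {z : ℤ | (z : ZMod L) = x}).measurableSet
      have e2 : (P.real {ω | (liftedWalk X n ω : ZMod L) = x} : ℂ) =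
          ∫ ω, (if (liftedWalk X n ω : ZMod L) = x then 1 else 0 : ℂ) ∂P := by
        have e3 : (fun ω => (if (liftedWalk X n ω : ZMod L) = x then 1 else 0 : ℂ)) =
            {ω | (liftedWalk X n ω : ZMod L) = x}.indicator (fun _ => (1 : ℂ)) := by
          funext ω
          simp [Set.indicator]
        rw [e3, integral_indicator hset]
        simp
      rw [e2]
      simp only [ite_eq_sum_stdAddChar hodd x]
      rw [integral_const_mul, integral_finsetSum]
      · simp only [integral_const_mul]
      · intro j _
        exact (integrable_comp_of_abs_le hmeas (abs_liftedWalk_le X n)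
          (fun s => ZMod.stdAddChar ((j * ((L + 1) / 2 : ℕ) : ZMod L) * (s : ZMod L)))).const_mul _
    have e4 : ((P.real {ω | (liftedWalk X n ω : ZMod L) = x} - 1 / L : ℝ) : ℂ) =
        (1 / L : ℂ) * ∑ j ∈ Finset.Ico 1 L,
          ZMod.stdAddChar (-((j * ((L + 1) / 2 : ℕ) : ZMod L) * x)) *
            ∫ ω, ZMod.stdAddChar ((j * ((L + 1) / 2 : ℕ) : ZMod L) *
              (liftedWalk X n ω : ZMod L)) ∂P := by
      rw [Complex.ofReal_sub, e1, Finset.range_eq_Ico, Finset.sum_eq_sum_Ico_succ_bot (by omega)]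
      simp
      ring
    rw [← Real.norm_eq_abs, ← Complex.norm_real, e4, norm_mul]
    have e5 : ‖(1 / L : ℂ)‖ = 1 / L := by simp
    rw [e5, one_div_mul_eq_div]
    refine div_le_div_of_nonneg_right ((norm_sum_le _ _).trans (Finset.sum_le_sum fun j _ => ?_))
      hL0.le
    rw [norm_mul, AddChar.norm_apply, one_mul]
    exact hφ j
  have hD0 : 0 ≤ D := by
    have := (abs_nonneg _).trans (hpoint 0)
    by_contra hneg
    have := div_neg_of_neg_of_pos (not_le.1 hneg) hL0
    linarith
  refine ciSup_le fun A => ?_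
  have hA : A = ((Set.toFinite A).toFinset : Set (ZMod L)) := by simp
  have : IsProbabilityMeasure (P.map (S n)) := by
    rw [Measure.map_congr (h.ae_eq_liftedWalk hL n)]
    exact Measure.isProbabilityMeasure_map
      ((measurable_of_countable (fun z : ℤ => (z : ZMod L))).comp hmeas).aemeasurable
  set s := (Set.toFinite A).toFinset
  rw [hA, uniformOn_univ_real_coe, ← sum_measureReal_singleton]
  have e6 : ∑ x ∈ s, (P.map (S n)).real {x} - s.card / L =
      ∑ x ∈ s, (P.real {ω | (liftedWalk X n ω : ZMod L) = x} - 1 / L) := by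
    rw [Finset.sum_sub_distrib, Finset.sum_const, nsmul_eq_mul, mul_one_div]
    congr 1
    refine Finset.sum_congr rfl fun x _ => ?_
    rw [h.map_real_apply hL]
    rfl
  rw [e6]
  calc _ ≤ ∑ x ∈ s, |P.real {ω | (liftedWalk X n ω : ZMod L) = x} - 1 / L| :=
        Finset.abs_sum_le_sum_abs _ _
    _ ≤ ∑ x ∈ s, D / L := Finset.sum_le_sum fun x _ => hpoint x
    _ = s.card * (D / L) := by rw [Finset.sum_const, nsmul_eq_mul]
    _ ≤ L * (D / L) := by
      gcongr
      have := Finset.card_le_univ s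
      rwa [ZMod.card] at this
    _ = D := by field_simp

end Driven

/-! ### Second moments and the lower bound -/

/-- The second moment of the lifted walk, defined by its recursion; see `walkMean_sq`. -/
noncomputable def secondMoment (α : ℝ) : ℕ → ℝ
  | 0 => 0
  | n + 1 => (1 + 2 * α / n) * secondMoment α n + 1

lemma walkMean_sq (α : ℝ) (n : ℕ) :
    walkMean α n (fun s : ℤ => ((s : ℂ) ^ 2)) = (secondMoment α n : ℂ) := by
  have hone : ∀ n, walkMean α n (fun _ : ℤ => (1 : ℂ)) = 1 := by
    intro n
    induction n with
    | zero => rfl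
    | succ n ih =>
      have e : walkStep α n (fun _ : ℤ => (1 : ℂ)) = fun _ => 1 := by
        funext s
        simp only [walkStep, Complex.real_smul]
        push_cast
        ring
      rw [walkMean, e, ih]
  induction n with
  | zero => simp [walkMean, secondMoment]
  | succ n ih =>
    have e : walkStep α n (fun s : ℤ => ((s : ℂ) ^ 2)) = fun s : ℤ =>
        (1 + 2 * α / n : ℂ) * ((s : ℂ) ^ 2) + 1 * (fun _ : ℤ => (1 : ℂ)) s := by
      funext s
      simp only [walkStep, Complex.real_smul]
      push_cast
      ring
    rw [walkMean, e, walkMean_linear, ih, hone, secondMoment]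
    push_cast
    ring

lemma secondMoment_le_of_lt_half {α : ℝ} (h0 : 0 ≤ α) (h : α < 1 / 2) (n : ℕ) :
    secondMoment α n ≤ n / (1 - 2 * α) := by
  have hpos : 0 < 1 - 2 * α := by linarith
  induction n with
  | zero => simp [secondMoment]
  | succ n ih =>
    rcases Nat.eq_zero_or_pos n with rfl | hn
    · simp only [secondMoment]
      rw [le_div_iff₀ hpos]
      push_cast
      linarith
    · have hn0 : (0 : ℝ) < n := by exact_mod_cast hn
      rw [secondMoment]
      calc (1 + 2 * α / n) * secondMoment α n + 1 ≤ (1 + 2 * α / n) * (n / (1 - 2 * α)) + 1 := by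
            gcongr
        _ = ((n + 1 : ℕ) : ℝ) / (1 - 2 * α) := by
            push_cast
            field_simp
            ring

lemma secondMoment_half_le (n : ℕ) (hn : 1 ≤ n) :
    secondMoment (1 / 2) n ≤ n * (1 + Real.log n) := by
  induction n, hn using Nat.le_induction with
  | base => simp [secondMoment]
  | succ n hn ih =>
    have hn0 : (0 : ℝ) < n := by exact_mod_cast hn
    rw [secondMoment]
    have h2 : (1 : ℝ) / (n + 1) ≤ Real.log (n + 1) - Real.log n := by
      have := Real.one_sub_inv_le_log_of_pos (x := ((n : ℝ) + 1) / n) (by positivity)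
      rw [Real.log_div (by positivity) (by positivity)] at this
      refine le_trans (le_of_eq ?_) this
      field_simp
      ring
    have h3 : (1 : ℝ) ≤ (n + 1) * (Real.log (n + 1) - Real.log n) := by
      rw [div_le_iff₀ (by positivity)] at h2
      linarith
    calc (1 + 2 * (1 / 2) / n) * secondMoment (1 / 2) n + 1
        ≤ (1 + 2 * (1 / 2) / n) * (n * (1 + Real.log n)) + 1 := by gcongr
      _ = (n + 1) * (1 + Real.log n) + 1 := by field_simp
      _ ≤ _ := by push_cast; linarith

lemma secondMoment_le_of_half_lt {α : ℝ} (h : 1 / 2 < α) (n : ℕ) (hn : 1 ≤ n) :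
    secondMoment α n ≤ 2 * α / (2 * α - 1) * (n : ℝ) ^ (2 * α) := by
  have hpos : 0 < 2 * α - 1 := by linarith
  suffices H : secondMoment α n + n / (2 * α - 1) ≤ 2 * α / (2 * α - 1) * (n : ℝ) ^ (2 * α) by
    have : 0 ≤ (n : ℝ) / (2 * α - 1) := by positivity
    linarith
  induction n, hn using Nat.le_induction with
  | base =>
    simp only [secondMoment]
    simp
    refine le_of_eq ?_
    field_simp
    ring
  | succ n hn ih =>
    have hn0 : (0 : ℝ) < n := by exact_mod_cast hn
    have h2 : 1 + 2 * α * (1 / n) ≤ (1 + 1 / (n : ℝ)) ^ (2 * α) :=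
      one_add_mul_self_le_rpow_one_add (by have : 0 < 1 / (n : ℝ) := by positivity
                                           linarith) (by linarith)
    have e : ((n + 1 : ℕ) : ℝ) = n * (1 + 1 / n) := by push_cast; field_simp
    rw [secondMoment, e, Real.mul_rpow hn0.le (by positivity)]
    calc (1 + 2 * α / n) * secondMoment α n + 1 + n * (1 + 1 / n) / (2 * α - 1)
        = (1 + 2 * α * (1 / n)) * (secondMoment α n + n / (2 * α - 1)) := by
          field_simp
          ring
      _ ≤ (1 + 2 * α * (1 / n)) * (2 * α / (2 * α - 1) * (n : ℝ) ^ (2 * α)) := by gcongr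
      _ ≤ (1 + 1 / (n : ℝ)) ^ (2 * α) * (2 * α / (2 * α - 1) * (n : ℝ) ^ (2 * α)) := by gcongr
      _ = _ := by ring

section Driven

variable {Ω : Type*} [MeasurableSpace Ω] {L : ℕ} {P : Measure Ω}
  {α : unitInterval} {ξ : ℕ → Ω → Bool} {u : ℕ → Ω → ℕ} {Y X S : ℕ → Ω → ZMod L}

/-- The lower bound lemma: as long as the second moment is small compared with `L ^ 2`, the walk
is concentrated on a short arc around its starting point. -/
lemma IsSRRWDrivenBy.lt_tvDist [IsProbabilityMeasure P] (hL : 3 ≤ L)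
    (h : IsSRRWDrivenBy P α (cycleStep L) ξ u Y X S) {ε : ℝ} (hε : ε < 1)
    (hLε : 16 / (1 - ε) ≤ L) {n : ℕ}
    (hn : secondMoment α n ≤ (1 - ε) ^ 3 / 256 * (L : ℝ) ^ 2) :
    ε < tvDist (P.map (S n)) (uniformOn Set.univ) := by
  classical
  have : NeZero L := ⟨by omega⟩
  have hL0 : (0 : ℝ) < L := by exact_mod_cast (by omega : 0 < L)
  have hε0 : 0 < 1 - ε := by linarith
  have hmeas := h.measurable_liftedWalk n
  set ρ := (1 - ε) / 8 * L with hρ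
  have hρ0 : 0 < ρ := by positivity
  set A : Finset (ZMod L) := (Finset.Icc (-⌊ρ⌋) ⌊ρ⌋).image (fun z : ℤ => (z : ZMod L)) with hA
  have hcheb : P.real {ω | ρ ^ 2 ≤ (liftedWalk X n ω : ℝ) ^ 2} ≤ (1 - ε) / 4 := by
    have hint : Integrable (fun ω => ((liftedWalk X n ω : ℝ) ^ 2)) P := by
      have := (integrable_comp_of_abs_le (P := P) hmeas (abs_liftedWalk_le X n)
        (fun s => ((s : ℂ) ^ 2))).re
      refine this.congr (Filter.Eventually.of_forall fun ω => ?_)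
      simp [← Complex.ofReal_intCast, ← Complex.ofReal_pow]
    have hmom : ∫ ω, ((liftedWalk X n ω : ℝ) ^ 2) ∂P = secondMoment α n := by
      have h1 := h.integral_liftedWalk hL n (fun s => ((s : ℂ) ^ 2))
      rw [walkMean_sq] at h1
      have h2 : ∫ ω, ((liftedWalk X n ω : ℂ) ^ 2) ∂P =
          ((∫ ω, ((liftedWalk X n ω : ℝ) ^ 2) ∂P : ℝ) : ℂ) := by
        rw [← integral_complex_ofReal]
        simp
      rw [h2] at h1
      exact_mod_cast h1
    have h3 := mul_meas_ge_le_integral_of_nonneg (μ := P)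
      (Filter.Eventually.of_forall fun ω => sq_nonneg (liftedWalk X n ω : ℝ)) hint (ρ ^ 2)
    rw [hmom] at h3
    have h4 : ρ ^ 2 * P.real {ω | ρ ^ 2 ≤ (liftedWalk X n ω : ℝ) ^ 2} ≤ ρ ^ 2 * ((1 - ε) / 4) := by
      refine h3.trans (hn.trans (le_of_eq ?_))
      rw [hρ]
      ring
    exact le_of_mul_le_mul_left h4 (by positivity)
  have hwalk : 1 - (1 - ε) / 4 ≤ (P.map (S n)).real A := by
    rw [h.map_real_apply hL]
    have hset : MeasurableSet {ω | ρ ^ 2 ≤ (liftedWalk X n ω : ℝ) ^ 2} :=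
      (measurable_of_countable fun z : ℤ => (z : ℝ) ^ 2).comp hmeas measurableSet_Ici
    have h5 := probReal_compl_eq_one_sub (μ := P) hset
    have h6 : P.real {ω | ρ ^ 2 ≤ (liftedWalk X n ω : ℝ) ^ 2}ᶜ ≤
        P.real {ω | (liftedWalk X n ω : ZMod L) ∈ (A : Set (ZMod L))} := by
      refine measureReal_mono fun ω hω => ?_
      have h7 : (liftedWalk X n ω : ℝ) ^ 2 < ρ ^ 2 := not_le.1 hω
      have h8 := abs_lt.1 (abs_lt_of_sq_lt_sq h7 hρ0.le)
      refine Finset.mem_coe.2 (Finset.mem_image.2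
        ⟨liftedWalk X n ω, Finset.mem_Icc.2 ⟨?_, ?_⟩, rfl⟩)
      · rw [neg_le, Int.le_floor]
        push_cast
        linarith
      · rw [Int.le_floor]
        linarith
    linarith
  have hunif : (uniformOn (Set.univ : Set (ZMod L))).real A ≤ (1 - ε) / 4 + (1 - ε) / 16 := by
    rw [uniformOn_univ_real_coe, div_le_iff₀ hL0]
    have h9 : (A.card : ℝ) ≤ 2 * ρ + 1 := by
      have hf0 : 0 ≤ ⌊ρ⌋ := Int.floor_nonneg.2 hρ0.le
      have h10 : (A.card : ℤ) ≤ 2 * ⌊ρ⌋ + 1 := by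
        have := (Finset.card_image_le (s := Finset.Icc (-⌊ρ⌋) ⌊ρ⌋) (f := fun z : ℤ => (z : ZMod L)))
        rw [← hA, Int.card_Icc] at this
        omega
      have h11 : (A.card : ℝ) ≤ 2 * (⌊ρ⌋ : ℝ) + 1 := by exact_mod_cast h10
      have := Int.floor_le ρ
      linarith
    have h12 : 16 ≤ L * (1 - ε) := (div_le_iff₀ hε0).1 hLε
    rw [hρ] at h9
    linarith
  have hle : |(P.map (S n)).real A - (uniformOn (Set.univ : Set (ZMod L))).real A| ≤
      tvDist (P.map (S n)) (uniformOn Set.univ) :=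
    le_ciSup (f := fun B : Set (ZMod L) =>
      |(P.map (S n)).real B - (uniformOn (Set.univ : Set (ZMod L))).real B|)
      (Set.finite_range _).bddAbove (A : Set (ZMod L))
  have := le_abs_self ((P.map (S n)).real A - (uniformOn (Set.univ : Set (ZMod L))).real A)
  linarith

end Driven

/-! ### Mixing times -/

lemma mixingTime_bounds {Ω G : Type*} [MeasurableSpace Ω] [MeasurableSpace G] {P : Measure Ω}
    {S : ℕ → Ω → G} {ε a b : ℝ} (hb : 1 ≤ b)
    (hlow : ∀ n : ℕ, 1 ≤ n → (n : ℝ) < a → ε < tvDist (P.map (S n)) (uniformOn Set.univ))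
    (hup : ∀ n : ℕ, b ≤ n → tvDist (P.map (S n)) (uniformOn Set.univ) ≤ ε) :
    a ≤ (mixingTime P S ε : ℝ) ∧ (mixingTime P S ε : ℝ) ≤ 2 * b := by
  have hmem : ⌈b⌉₊ ∈ mixedTimes P S ε :=
    ⟨Nat.one_le_ceil_iff.2 (by linarith), fun m hm => hup m (Nat.ceil_le.1 hm)⟩
  constructor
  · have h := Nat.sInf_mem ⟨_, hmem⟩
    by_contra hlt
    exact absurd (h.2 _ le_rfl) (not_le.2 (hlow _ h.1 (not_le.1 hlt)))
  · have h1 : mixingTime P S ε ≤ ⌈b⌉₊ := Nat.sInf_le hmem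
    have h2 : (mixingTime P S ε : ℝ) ≤ ⌈b⌉₊ := by exact_mod_cast h1
    have h3 := Nat.ceil_lt_add_one (by linarith : 0 ≤ b)
    linarith

/-- If the scale `τ L` is such that the second moment is at most `(1 - ε) ^ 3 / 256 * L ^ 2` up to
time `c * τ L`, and that the characteristic function decays exponentially in the frequency
after time `τ L`, then the mixing time is of order `τ L`. -/
lemma exists_mixingTime_bounds {α : unitInterval} {ε : ℝ} (hε0 : 0 < ε) (hε1 : ε < 1)
    {τ : ℕ → ℝ} (hτ : ∀ L : ℕ, 3 ≤ L → 1 ≤ τ L)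
    (hlow : ∃ c : ℝ, 0 < c ∧ ∀ L : ℕ, 3 ≤ L → ∀ n : ℕ, 1 ≤ n → (n : ℝ) < c * τ L →
      secondMoment α n ≤ (1 - ε) ^ 3 / 256 * (L : ℝ) ^ 2)
    (hup : ∃ a : ℝ, 0 < a ∧ ∃ L₀ : ℕ, ∀ L : ℕ, L₀ ≤ L → ∀ C : ℝ, 1 ≤ C → ∀ n : ℕ,
      C * τ L ≤ n → ∀ j : ℕ, 1 ≤ j → 2 * j ≤ L →
        cosProdMean α n (Real.pi * j / L) ≤ Real.exp (-(a * C * j))) :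
    ∃ c C : ℝ, 0 < c ∧ 0 < C ∧ ∃ L₀ : ℕ, ∀ L : ℕ, L₀ ≤ L → 3 ≤ L → Odd L →
      ∀ (Ω : Type w) [MeasurableSpace Ω] (P : Measure Ω) [IsProbabilityMeasure P]
        (S : ℕ → Ω → ZMod L), IsSRRW P α (cycleStep L) S →
        c * τ L ≤ (mixingTime P S ε : ℝ) ∧ (mixingTime P S ε : ℝ) ≤ C * τ L := by
  obtain ⟨c, hc, hlow⟩ := hlow
  obtain ⟨a, ha, L₀, hup⟩ := hup
  set C := max 1 (Real.log (4 / ε) / a) with hC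
  have hC1 : 1 ≤ C := le_max_left _ _
  have hexp : Real.exp (-(a * C)) ≤ ε / 4 := by
    have h1 : Real.log (4 / ε) ≤ a * C := by
      have := le_max_right 1 (Real.log (4 / ε) / a)
      rw [← hC, div_le_iff₀ ha] at this
      linarith
    calc Real.exp (-(a * C)) ≤ Real.exp (-Real.log (4 / ε)) := Real.exp_le_exp.2 (neg_le_neg h1)
      _ = ε / 4 := by rw [Real.exp_neg, Real.exp_log (by positivity), inv_div]
  refine ⟨c, 2 * C, hc, by linarith, max L₀ ⌈16 / (1 - ε)⌉₊, ?_⟩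
  intro L hL hL3 hodd Ω _ P _ S hS
  obtain ⟨ξ, u, Y, X, h⟩ := hS
  have hLε : 16 / (1 - ε) ≤ L :=
    (Nat.le_ceil _).trans (by exact_mod_cast (le_max_right _ _).trans hL)
  have hτL := hτ L hL3
  rw [mul_assoc]
  refine mixingTime_bounds (by nlinarith) (fun n hn hna => ?_) fun n hn => ?_
  · exact h.lt_tvDist hL3 hε1 hLε (hlow L hL3 n hn hna)
  · refine (h.tvDist_le_sum hL3 hodd n).trans ?_
    have := sum_cosProdMean_le α.2.1 α.2.2 (b := a * C) (by linarith)
      (hup L ((le_max_left _ _).trans hL) C hC1 n hn)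
    linarith

theorem theorem1p6 (α : unitInterval) (hα : (α : ℝ) < 1) (ε : ℝ) (hε0 : 0 < ε) (hε1 : ε < 1) :
    ((α : ℝ) < 1 / 2 → ∃ c C : ℝ, 0 < c ∧ 0 < C ∧ ∃ L₀ : ℕ, ∀ L : ℕ, L₀ ≤ L → 3 ≤ L → Odd L →
      ∀ (Ω : Type w) [MeasurableSpace Ω] (P : Measure Ω) [IsProbabilityMeasure P]
        (S : ℕ → Ω → ZMod L), IsSRRW P α (cycleStep L) S →
        c * (L : ℝ) ^ 2 ≤ (mixingTime P S ε : ℝ) ∧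
          (mixingTime P S ε : ℝ) ≤ C * (L : ℝ) ^ 2) ∧
    ((α : ℝ) = 1 / 2 → ∃ c C : ℝ, 0 < c ∧ 0 < C ∧ ∃ L₀ : ℕ, ∀ L : ℕ, L₀ ≤ L → 3 ≤ L → Odd L →
      ∀ (Ω : Type w) [MeasurableSpace Ω] (P : Measure Ω) [IsProbabilityMeasure P]
        (S : ℕ → Ω → ZMod L), IsSRRW P α (cycleStep L) S →
        c * (L : ℝ) ^ 2 / Real.log L ≤ (mixingTime P S ε : ℝ) ∧
          (mixingTime P S ε : ℝ) ≤ C * (L : ℝ) ^ 2 / Real.log L) ∧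
    (1 / 2 < (α : ℝ) → ∃ c C : ℝ, 0 < c ∧ 0 < C ∧ ∃ L₀ : ℕ, ∀ L : ℕ, L₀ ≤ L → 3 ≤ L → Odd L →
      ∀ (Ω : Type w) [MeasurableSpace Ω] (P : Measure Ω) [IsProbabilityMeasure P]
        (S : ℕ → Ω → ZMod L), IsSRRW P α (cycleStep L) S →
        c * (L : ℝ) ^ (1 / (α : ℝ)) ≤ (mixingTime P S ε : ℝ) ∧
          (mixingTime P S ε : ℝ) ≤ C * (L : ℝ) ^ (1 / (α : ℝ))) := by
  have h0 : 0 ≤ (α : ℝ) := α.2.1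
  set κ := (1 - ε) ^ 3 / 256 with hκ
  have hκ0 : 0 < κ := by
    have : 0 < 1 - ε := by linarith
    positivity
  have hκ1 : κ ≤ 1 := by
    have : (1 - ε) ^ 3 ≤ 1 := pow_le_one₀ (by linarith) (by linarith)
    rw [hκ]; linarith
  refine ⟨fun hhalf => ?_, fun hhalf => ?_, fun hhalf => ?_⟩
  · refine exists_mixingTime_bounds hε0 hε1 (τ := fun L => (L : ℝ) ^ 2) (fun L hL => ?_) ?_
      (exists_cosProdMean_cycle_le_subcritical h0 hα)
    · have : (3 : ℝ) ≤ L := by exact_mod_cast hL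
      nlinarith
    · have h2 : 0 < 1 - 2 * (α : ℝ) := by linarith
      refine ⟨κ * (1 - 2 * α), by positivity, fun L _ n _ hn => ?_⟩
      refine (secondMoment_le_of_lt_half h0 hhalf n).trans ?_
      rw [div_le_iff₀ h2, ← hκ]
      linarith
  · have hlogpos : ∀ L : ℕ, 3 ≤ L → 1 ≤ Real.log L := fun L hL => by
      rw [Real.le_log_iff_exp_le (by positivity)]
      have : (3 : ℝ) ≤ L := by exact_mod_cast hL
      linarith [Real.exp_one_lt_d9]
    have hmain := exists_mixingTime_bounds (α := α) hε0 hε1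
      (τ := fun L => (L : ℝ) ^ 2 / Real.log L) (fun L hL => ?_) ?_ ?_
    · simpa only [mul_div_assoc] using hmain
    · have hL3 : (3 : ℝ) ≤ L := by exact_mod_cast hL
      have := hlogpos L hL
      rw [le_div_iff₀ (by linarith)]
      have := Real.log_le_sub_one_of_pos (by linarith : (0 : ℝ) < L)
      nlinarith
    · refine ⟨κ / 3, by positivity, fun L hL n hn1 hn => ?_⟩
      have hL3 : (3 : ℝ) ≤ L := by exact_mod_cast hL
      have hlog := hlogpos L hL
      have hn0 : (1 : ℝ) ≤ n := by exact_mod_cast hn1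
      rw [hhalf]
      have hnL : (n : ℝ) * Real.log L ≤ κ / 3 * L ^ 2 := by
        rw [← mul_div_assoc, lt_div_iff₀ (by linarith)] at hn
        exact hn.le
      have hn2 : (n : ℝ) ≤ L ^ 2 := by nlinarith [sq_nonneg (L : ℝ)]
      have hlogn : Real.log n ≤ 2 * Real.log L := by
        have := Real.log_le_log (by linarith) hn2
        rwa [Real.log_pow, Nat.cast_two] at this
      calc secondMoment (1 / 2) n ≤ n * (1 + Real.log n) := secondMoment_half_le n hn1
        _ ≤ n * (3 * Real.log L) := by gcongr; linarith
        _ ≤ _ := by rw [← hκ]; linarith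
    · rw [hhalf]
      simpa only [mul_div_assoc] using exists_cosProdMean_cycle_le_critical
  · have hα0 : 0 < (α : ℝ) := by linarith
    refine exists_mixingTime_bounds hε0 hε1 (τ := fun L => (L : ℝ) ^ (1 / (α : ℝ)))
      (fun L hL => ?_) ?_ (exists_cosProdMean_cycle_le_supercritical hα0 hα)
    · have : (3 : ℝ) ≤ L := by exact_mod_cast hL
      exact Real.one_le_rpow (by linarith) (by positivity)
    · have h2 : 0 < 2 * (α : ℝ) - 1 := by linarith
      set D := 2 * (α : ℝ) / (2 * α - 1) with hD
      have hD0 : 0 < D := by positivity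
      refine ⟨(κ / D) ^ (1 / (2 * (α : ℝ))), by positivity, fun L hL n hn1 hn => ?_⟩
      have hL0 : (0 : ℝ) < L := by exact_mod_cast (by omega : 0 < L)
      calc secondMoment α n ≤ D * (n : ℝ) ^ (2 * (α : ℝ)) := secondMoment_le_of_half_lt hhalf n hn1
        _ ≤ D * ((κ / D) ^ (1 / (2 * (α : ℝ))) * (L : ℝ) ^ (1 / (α : ℝ))) ^ (2 * (α : ℝ)) := by
            gcongr
        _ = D * (κ / D * L ^ 2) := by
            rw [Real.mul_rpow (by positivity) (by positivity), ← Real.rpow_mul (by positivity),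
              ← Real.rpow_mul hL0.le, one_div_mul_cancel (by positivity), Real.rpow_one,
              ← Real.rpow_natCast]
            congr 3
            field_simp
            norm_num
        _ = _ := by rw [← hκ]; field_simp
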